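/- Let $d \ge 2$ and let $G = SL_d(\mathbb{R}) \ltimes \mathbb{R}^d$ be the group of pairs $(A,v)$ with multiplication $(A,v)(B,w) = (AB, Aw+v)$. Let $\mathcal{X}$ be the space of affine unimodular lattices in $\mathbb{R}^d$, i.e. of the subsets $A\mathbb{Z}^d + v$ with $(A,v) \in G$. The group $G$ acts transitively on $\mathcal{X}$ by $(A,v)\cdot\Lambda = A\Lambda + v$, so that $\mathcal{X} \simeq G/(SL_d(\mathbb{Z}) \ltimes \mathbb{Z}^d)$; give $\mathcal{X}$ the quotient topology and its Borel $\sigma$-algebra, and let $\mu_{\mathcal{X}}$ be the $G$-invariant Borel probability measure on $\mathcal{X}$. For $f : \mathbb{R}^d \to \mathbb{R}$ the Siegel transform is $$\hat f(\Lambda) = \sum_{z \in \Lambda \setminus \{0\}} f(z), \qquad \Lambda \in \mathcal{X}.$$ If $f \in L^1(\mathbb{R}^d) \cap L^2(\mathbb{R}^d)$, then the series defining $\hat f(\Lambda)$ converges absolutely for $\mu_{\mathcal{X}}$-almost every $\Lambda$, $\hat f \in L^2(\mathcal{X}, \mu_{\mathcal{X}})$, and $$\int_{\mathcal{X}} \hat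 f(\Lambda)\, d\mu_{\mathcal{X}}(\Lambda) = \int_{\mathbb{R}^d} f(x)\,dx, \qquad \int_{\mathcal{X}} \hat f(\Lambda)^2 \, d\mu_{\mathcal{X}}(\Lambda) = \Big(\int_{\mathbb{R}^d} f(x)\,dx\Big)^2 + \int_{\mathbb{R}^d} f(x)^2\,dx .$$ -/

import Mathlib

open MeasureTheory
open scoped Matrix

/-- The group `SL_d(ℝ) ⋉ ℝ^d` of volume and orientation preserving affine transformations
`w ↦ A w + v` of `ℝ^d`; an element is a pair `(A, v)`. -/
@[ext]
structure AffSL (d : ℕ) where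
  lin : Matrix.SpecialLinearGroup (Fin d) ℝ
  trans : Fin d → ℝ

namespace AffSL

variable {d : ℕ}

/-- The affine map `w ↦ A w + v` given by the pair `(A, v)`. -/
def toFun (g : AffSL d) (w : Fin d → ℝ) : Fin d → ℝ :=
  (g.lin : Matrix (Fin d) (Fin d) ℝ) *ᵥ w + g.trans

/-- `(A, v) (B, w) = (A B, A w + v)`. -/
instance : Mul (AffSL d) :=
  ⟨fun g h => ⟨g.lin * h.lin, (g.lin : Matrix (Fin d) (Fin d) ℝ) *ᵥ h.trans + g.trans⟩⟩

instance : One (AffSL d) := ⟨⟨1, 0⟩⟩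

instance : Inv (AffSL d) :=
  ⟨fun g => ⟨g.lin⁻¹, -(((g.lin⁻¹ : Matrix.SpecialLinearGroup (Fin d) ℝ) :
    Matrix (Fin d) (Fin d) ℝ) *ᵥ g.trans)⟩⟩

theorem mul_lin (g h : AffSL d) : (g * h).lin = g.lin * h.lin := rfl

theorem mul_trans (g h : AffSL d) :
    (g * h).trans = (g.lin : Matrix (Fin d) (Fin d) ℝ) *ᵥ h.trans + g.trans := rfl

theorem one_lin : (1 : AffSL d).lin = 1 := rfl

theorem one_trans : (1 : AffSL d).trans = 0 := rfl

theorem inv_lin (g : AffSL d) : (g⁻¹).lin = g.lin⁻¹ := rfl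

theorem inv_trans (g : AffSL d) :
    (g⁻¹).trans = -(((g.lin⁻¹ : Matrix.SpecialLinearGroup (Fin d) ℝ) :
      Matrix (Fin d) (Fin d) ℝ) *ᵥ g.trans) := rfl

instance : Group (AffSL d) :=
  Group.ofLeftAxioms
    (fun a b c => by
      ext1
      · simp only [mul_lin, mul_assoc]
      · simp only [mul_lin, mul_trans, Matrix.SpecialLinearGroup.coe_mul, Matrix.mulVec_add,
          Matrix.mulVec_mulVec, add_assoc])
    (fun a => by
      ext1
      · simp only [mul_lin, one_lin, one_mul]
      · simp only [mul_trans, one_lin, one_trans, Matrix.SpecialLinearGroup.coe_one,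
          Matrix.one_mulVec, add_zero])
    (fun a => by
      ext1
      · simp only [mul_lin, inv_lin, one_lin, inv_mul_cancel]
      · simp only [mul_trans, inv_lin, inv_trans, one_trans, add_neg_cancel])

/-- The topology of the product `SL_d(ℝ) × ℝ^d`. -/
instance : TopologicalSpace (AffSL d) :=
  TopologicalSpace.induced (fun g => (g.lin, g.trans)) inferInstance

theorem toFun_one (w : Fin d → ℝ) : (1 : AffSL d).toFun w = w := by
  simp [toFun, one_lin, one_trans]

theorem toFun_mul (g h : AffSL d) (w : Fin d → ℝ) : (g * h).toFun w = g.toFun (h.toFun w) := by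
  simp only [toFun, mul_lin, mul_trans, Matrix.SpecialLinearGroup.coe_mul, Matrix.mulVec_add,
    Matrix.mulVec_mulVec, add_assoc]

end AffSL

/-- The standard lattice `ℤ^d` in `ℝ^d`. -/
def stdLattice (d : ℕ) : Set (Fin d → ℝ) :=
  Set.range fun (p : Fin d → ℤ) (i : Fin d) => (p i : ℝ)

/-- The space of affine unimodular lattices in `ℝ^d`: the subsets of the form `A ℤ^d + v` with
`A ∈ SL_d(ℝ)` and `v ∈ ℝ^d`. -/
def AffineUnimodularLattice (d : ℕ) : Type :=
  {Λ : Set (Fin d → ℝ) // ∃ g : AffSL d, Λ = g.toFun '' stdLattice d}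

namespace AffineUnimodularLattice

variable {d : ℕ}

/-- The action `(A, v) • Λ = A Λ + v`. -/
instance : MulAction (AffSL d) (AffineUnimodularLattice d) where
  smul g Λ := ⟨g.toFun '' Λ.1, by
    obtain ⟨h, hh⟩ := Λ.2
    refine ⟨g * h, ?_⟩
    rw [hh, Set.image_image]
    exact Set.image_congr fun w _ => (AffSL.toFun_mul g h w).symm⟩
  one_smul Λ := Subtype.ext (by
    change (1 : AffSL d).toFun '' Λ.1 = Λ.1
    simp [AffSL.toFun_one])
  mul_smul g h Λ := Subtype.ext (by
    change (g * h).toFun '' Λ.1 = g.toFun '' (h.toFun '' Λ.1)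
    rw [Set.image_image]
    exact Set.image_congr fun w _ => AffSL.toFun_mul g h w)

/-- The lattice `ℤ^d` as a point of the space of affine unimodular lattices. -/
def std (d : ℕ) : AffineUnimodularLattice d :=
  ⟨stdLattice d, 1, by simp [AffSL.toFun_one]⟩

/-- The quotient topology for the surjective orbit map `(A, v) ↦ A ℤ^d + v`, i.e. the topology of
the homogeneous space `(SL_d(ℝ) ⋉ ℝ^d) / (SL_d(ℤ) ⋉ ℤ^d)`. -/
instance : TopologicalSpace (AffineUnimodularLattice d) :=
  TopologicalSpace.coinduced (fun g : AffSL d => g • std d) inferInstance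

instance : MeasurableSpace (AffineUnimodularLattice d) := borel _

instance : BorelSpace (AffineUnimodularLattice d) := ⟨rfl⟩

end AffineUnimodularLattice

/-- The Siegel transform `f̂(Λ) = ∑_{z ∈ Λ ∖ {0}} f(z)` (as an unconditional sum). -/
noncomputable def siegelTransform {d : ℕ} (f : (Fin d → ℝ) → ℝ)
    (Λ : AffineUnimodularLattice d) : ℝ :=
  ∑' z : ↥(Λ.1 \ {0}), f z

/-!
For nonnegative measurable `f` both moments are computed for the sum over all points of `Λ`, and
the general case follows by decomposing `f` into positive and negative parts. Almost every affine
lattice avoids a given null set (`SiegelMean.ae_forall_mem_notMem`), so neither the origin nor the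
choice of a representative of `f` matters, and the second moment of the signed function is
recovered from those of `f⁺`, `f⁻` and `|f|` by polarization.

For nonnegative `f`, the invariant probability measure `μ` on the space of affine lattices is made
explicit first. A fundamental domain is replaced by a weight whose sum over each orbit of the
discrete group is one (`SiegelMean.IsOrbitWeight`); such a weight exists because orbits have
finitely many points of least height. The Fubini argument for the uniqueness of Haar measure,
applied to `μ` and to the measure on the affine group coming from Lebesgue measure on the cone
`{B | 0 < det B ≤ 1}` and on the translations, expresses `∫ F dμ` as an average over unimodular
lattices `L` and over translations `t` in a fundamental parallelepiped of `L`
(`SiegelMean.lintegral_eq_unfold`). Averaging `∑ f` over `t` alone gives `∫ f`, which is the first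
moment. Averaging `(∑ f)²` over `t` gives `∑_{u ∈ L} ∫ f(x) f(x + u) dx`: the term `u = 0` is
`∫ f²`, and the average over `L` of the remaining terms is `(∫ f)²` by Siegel's mean value theorem
for unimodular lattices, `SiegelMean.siegel_mean_value`.

The mean value theorem says that the average over `L` of `∑_{u ∈ L ∖ {0}} H(u)` is `∫ H`. Every
nonzero lattice vector is in a unique way a positive multiple of a primitive one, and the primitive
vectors form one orbit of `SL_n(ℤ)` with stabiliser `SL_{n-1}(ℤ) ⋉ ℤ^{n-1}`. Unfolding along this
orbit shows that the average is `C ∫ H` up to normalisation, where `C` is bounded by `ζ(n)` times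
the covolume of `SL_{n-1}(ℤ)` (`SiegelMean.lintegral_mul_tsum_latVec`). Since by Minkowski's
theorem every unimodular lattice has a nonzero vector in a fixed ball, the same formula gives the
finiteness of the covolumes by induction on `n` (`SiegelMean.IsOrbitWeight.lintegral_ne_top`).
Finally `C` is identified without computing zeta values: for `H` the indicator of a ball of radius
`r`, lattice point counts divided by `r ^ n` converge to the volume of the unit ball, and dominated
convergence as `r → ∞` gives the normalisation.

Lattices are spanned by the rows of a matrix in the linear part of the argument, so that `SL_n(ℤ)`
acts by multiplication on the left.
-/

open scoped ENNReal

namespace SiegelMean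

/-! ### Lebesgue measure on matrices -/

/-- Matrices carry the product `σ`-algebra and Lebesgue measure of their entries. -/
noncomputable instance matrixMeasureSpace {m n : ℕ} :
    MeasureSpace (Matrix (Fin m) (Fin n) ℝ) :=
  inferInstanceAs (MeasureSpace (Fin m → Fin n → ℝ))

instance {m n : ℕ} : BorelSpace (Matrix (Fin m) (Fin n) ℝ) :=
  inferInstanceAs (BorelSpace (Fin m → Fin n → ℝ))

instance {m n : ℕ} : SecondCountableTopology (Matrix (Fin m) (Fin n) ℝ) :=
  inferInstanceAs (SecondCountableTopology (Fin m → Fin n → ℝ))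

instance {m n : ℕ} : PolishSpace (Matrix (Fin m) (Fin n) ℝ) :=
  inferInstanceAs (PolishSpace (Fin m → Fin n → ℝ))

instance {m n : ℕ} : SigmaFinite (volume : Measure (Matrix (Fin m) (Fin n) ℝ)) :=
  inferInstanceAs (SigmaFinite (volume : Measure (Fin m → Fin n → ℝ)))

theorem measurePreserving_vecMul {n : ℕ} {h : Matrix (Fin n) (Fin n) ℝ} (hh : h.det = 1) :
    MeasurePreserving (fun v : Fin n → ℝ => v ᵥ* h) := by
  have hd : (hᵀ).det ≠ 0 := by simp [hh]
  have := Real.map_matrix_volume_pi_eq_smul_volume_pi hd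
  refine ⟨by fun_prop, ?_⟩
  have e : (fun v : Fin n → ℝ => v ᵥ* h) = Matrix.toLin' hᵀ := by
    ext v; simp [Matrix.mulVec_transpose]
  rw [e, this]
  simp [hh]

theorem measurePreserving_mul_right {m n : ℕ} {h : Matrix (Fin n) (Fin n) ℝ} (hh : h.det = 1) :
    MeasurePreserving (fun B : Matrix (Fin m) (Fin n) ℝ => B * h) :=
  volume_preserving_pi (fun _ : Fin m => measurePreserving_vecMul hh)

theorem measurePreserving_transpose {m n : ℕ} :
    MeasurePreserving (fun B : Matrix (Fin m) (Fin n) ℝ => Bᵀ) := by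
  let T : (Fin m → Fin n → ℝ) ≃L[ℝ] (Fin n → Fin m → ℝ) :=
    { toFun := fun B i j => B j i
      invFun := fun B i j => B j i
      map_add' := fun _ _ => rfl
      map_smul' := fun _ _ => rfl
      left_inv := fun _ => rfl
      right_inv := fun _ => rfl
      continuous_toFun := by fun_prop
      continuous_invFun := by fun_prop }
  have hm : Measurable T := T.continuous.measurable
  have hc : ∀ a b : ℕ, (volume : Measure (Fin a → Fin b → ℝ)) (Set.Icc 0 1) = 1 := by
    intro a b
    have h0 : (Set.Icc 0 1 : Set (Fin a → Fin b → ℝ)) = Set.pi Set.univ fun _ => Set.Icc 0 1 := by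
      rw [← Set.pi_univ_Icc]; rfl
    rw [h0, volume_pi_pi]
    simp [Real.volume_Icc_pi]
  have hV : ∀ a b : ℕ, (volume : Measure (Fin a → Fin b → ℝ)).IsAddHaarMeasure := fun a b => {}
  have := hV m n
  have := hV n m
  have hH : ((volume : Measure (Fin m → Fin n → ℝ)).map T).IsAddHaarMeasure :=
    T.isAddHaarMeasure_map _
  refine ⟨hm, ?_⟩
  change (volume : Measure (Fin m → Fin n → ℝ)).map T = (volume : Measure (Fin n → Fin m → ℝ))
  have h1 := Measure.isAddLeftInvariant_eq_smul ((volume : Measure (Fin m → Fin n → ℝ)).map T)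
    (volume : Measure (Fin n → Fin m → ℝ))
  have h2 := congrArg (fun M : Measure (Fin n → Fin m → ℝ) => M (Set.Icc 0 1)) h1
  have h3 : T ⁻¹' (Set.Icc 0 1) = Set.Icc 0 1 := by
    ext B
    simp only [Set.mem_preimage, Set.mem_Icc, Pi.le_def]
    exact ⟨fun h => ⟨fun i j => h.1 j i, fun i j => h.2 j i⟩,
      fun h => ⟨fun i j => h.1 j i, fun i j => h.2 j i⟩⟩
  simp only [Measure.map_apply hm measurableSet_Icc, h3, Measure.smul_apply, hc] at h2
  rw [h1]
  rw [ENNReal.smul_def, smul_eq_mul, mul_one] at h2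
  rw [ENNReal.smul_def, ← h2, one_smul]

theorem measurePreserving_mul_left {m n : ℕ} {h : Matrix (Fin m) (Fin m) ℝ} (hh : h.det = 1) :
    MeasurePreserving (fun B : Matrix (Fin m) (Fin n) ℝ => h * B) := by
  have hd : (hᵀ).det = 1 := by simp [hh]
  have := measurePreserving_transpose.comp
    ((measurePreserving_mul_right (m := n) hd).comp (measurePreserving_transpose (m := m) (n := n)))
  have e : (fun B : Matrix (Fin m) (Fin n) ℝ => h * B) =
      ((fun B => Bᵀ) ∘ (fun B => B * hᵀ) ∘ fun B => Bᵀ) := by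
    ext B : 1; simp [Matrix.transpose_mul]
  rw [e]; exact this

/-! ### Weights for the action of `SL_n(ℤ)` -/

/-- The real matrix underlying an element of `SL_n(ℤ)`. -/
def toR {n : ℕ} (γ : Matrix.SpecialLinearGroup (Fin n) ℤ) : Matrix (Fin n) (Fin n) ℝ :=
  γ.1.map (Int.cast : ℤ → ℝ)

theorem toR_apply {n : ℕ} (γ : Matrix.SpecialLinearGroup (Fin n) ℤ) (i j : Fin n) :
    toR γ i j = (γ.1 i j : ℝ) := rfl

theorem toR_one {n : ℕ} : toR (1 : Matrix.SpecialLinearGroup (Fin n) ℤ) = 1 := by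
  ext i j; simp [toR, Matrix.one_apply]

theorem toR_mul {n : ℕ} (γ δ : Matrix.SpecialLinearGroup (Fin n) ℤ) :
    toR (γ * δ) = toR γ * toR δ := by
  ext i j; simp [toR, Matrix.mul_apply]

theorem det_toR {n : ℕ} (γ : Matrix.SpecialLinearGroup (Fin n) ℤ) : (toR γ).det = 1 := by
  have := (Int.castRingHom ℝ).map_det γ.1
  rw [γ.2] at this
  simpa [toR] using this.symm

theorem det_toR_mul {n : ℕ} (γ : Matrix.SpecialLinearGroup (Fin n) ℤ)
    (B : Matrix (Fin n) (Fin n) ℝ) : (toR γ * B).det = B.det := by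
  rw [Matrix.det_mul, det_toR, one_mul]

instance {n : ℕ} : Countable (Matrix.SpecialLinearGroup (Fin n) ℤ) :=
  Function.Injective.countable (β := Fin n → Fin n → ℤ) (f := fun γ i j => γ.1 i j)
    fun _ _ h => Subtype.ext h

@[fun_prop]
theorem measurable_det {n : ℕ} : Measurable (fun B : Matrix (Fin n) (Fin n) ℝ => B.det) :=
  (continuous_id.matrix_det).measurable

@[fun_prop]
theorem measurable_toR_mul {m n : ℕ} (γ : Matrix.SpecialLinearGroup (Fin n) ℤ) :
    Measurable (fun B : Matrix (Fin n) (Fin m) ℝ => toR γ * B) :=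
  (measurePreserving_mul_left (det_toR γ)).measurable

/-- The cone over `SL_n(ℝ)` of the matrices `B` with `0 < det B ≤ 1`. -/
def detCone (n : ℕ) : Set (Matrix (Fin n) (Fin n) ℝ) := {B | 0 < B.det ∧ B.det ≤ 1}

/-- Lebesgue measure on the cone of matrices `B` with `0 < det B ≤ 1`. -/
noncomputable def coneMeasure (n : ℕ) : Measure (Matrix (Fin n) (Fin n) ℝ) :=
  volume.restrict (detCone n)

theorem measurableSet_detCone {n : ℕ} : MeasurableSet (detCone n) :=
  (measurableSet_lt measurable_const measurable_det).inter
    (measurableSet_le measurable_det measurable_const)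

instance {n : ℕ} : SigmaFinite (coneMeasure n) := by unfold coneMeasure; infer_instance

theorem coneMeasure_mul_left {n : ℕ} {h : Matrix (Fin n) (Fin n) ℝ} (hh : h.det = 1) :
    MeasurePreserving (fun B => h * B) (coneMeasure n) (coneMeasure n) := by
  have := (measurePreserving_mul_left (n := n) hh).restrict_preimage
    (measurableSet_detCone (n := n))
  simpa [Set.preimage, Matrix.det_mul, hh, coneMeasure, detCone] using this

theorem coneMeasure_mul_right {n : ℕ} {h : Matrix (Fin n) (Fin n) ℝ} (hh : h.det = 1) :
    MeasurePreserving (fun B => B * h) (coneMeasure n) (coneMeasure n) := by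
  have := (measurePreserving_mul_right (m := n) hh).restrict_preimage
    (measurableSet_detCone (n := n))
  simpa [Set.preimage, Matrix.det_mul, hh, coneMeasure, detCone] using this

theorem ae_coneMeasure {n : ℕ} : ∀ᵐ B ∂(coneMeasure n), 0 < B.det ∧ B.det ≤ 1 :=
  ae_restrict_mem measurableSet_detCone

/-- A weight `ψ` on matrices of positive determinant whose sum over each left `SL_n(ℤ)`-orbit
is `1`. It plays the role of the indicator of a fundamental domain. -/
structure IsOrbitWeight {n : ℕ} (ψ : Matrix (Fin n) (Fin n) ℝ → ℝ≥0∞) : Prop where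
  measurable : Measurable ψ
  tsum_eq_one : ∀ B, 0 < B.det → ∑' γ, ψ (toR γ * B) = 1

/-- The rounded up `ℓ¹`-size of the entries of a matrix. Each `SL_n(ℤ)`-orbit of an invertible
matrix has only finitely many points of bounded height. -/
noncomputable def height {n : ℕ} (B : Matrix (Fin n) (Fin n) ℝ) : ℕ := ⌈∑ i, ∑ j, |B i j|⌉₊

theorem measurable_height {n : ℕ} : Measurable (height (n := n)) := by
  refine Nat.measurable_ceil.comp ?_
  have : Continuous fun B : Matrix (Fin n) (Fin n) ℝ => ∑ i, ∑ j, |B i j| := by fun_prop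
  exact this.measurable

theorem finite_height_le {n : ℕ} {B : Matrix (Fin n) (Fin n) ℝ} (hB : 0 < B.det) (k : ℕ) :
    {γ : Matrix.SpecialLinearGroup (Fin n) ℤ | height (toR γ * B) ≤ k}.Finite := by
  set R : ℝ := k * ∑ l, ∑ j, |B⁻¹ l j|
  have key : ∀ γ : Matrix.SpecialLinearGroup (Fin n) ℤ, height (toR γ * B) ≤ k →
      ∀ i j, |(γ.1 i j : ℝ)| ≤ R := by
    intro γ hγ i j
    have h1 : toR γ = (toR γ * B) * B⁻¹ := by
      rw [Matrix.mul_assoc, Matrix.mul_nonsing_inv _ (isUnit_iff_ne_zero.2 hB.ne'), mul_one]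
    have h2 : ∑ i, ∑ j, |(toR γ * B) i j| ≤ k := Nat.ceil_le.1 hγ
    have h3 : ∀ l, |(toR γ * B) i l| ≤ k := fun l =>
      ((Finset.single_le_sum (f := fun l => |(toR γ * B) i l|) (fun _ _ => abs_nonneg _)
        (Finset.mem_univ l)).trans (Finset.single_le_sum
          (f := fun i => ∑ j, |(toR γ * B) i j|)
          (fun _ _ => Finset.sum_nonneg fun _ _ => abs_nonneg _) (Finset.mem_univ i))).trans h2
    rw [← toR_apply, h1, Matrix.mul_apply]
    refine (Finset.abs_sum_le_sum_abs _ _).trans ?_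
    simp only [R, Finset.mul_sum (s := Finset.univ) (a := (k : ℝ))
      (f := fun l => ∑ j, |B⁻¹ l j|)]
    refine Finset.sum_le_sum fun l _ => ?_
    rw [abs_mul]
    exact mul_le_mul (h3 l) (Finset.single_le_sum (f := fun j => |B⁻¹ l j|)
      (fun _ _ => abs_nonneg _) (Finset.mem_univ j)) (abs_nonneg _) (Nat.cast_nonneg _)
  have hfin : (Set.Icc (fun _ _ => -⌈R⌉) (fun _ _ => ⌈R⌉) : Set (Fin n → Fin n → ℤ)).Finite :=
    Set.finite_Icc _ _
  refine Set.Finite.of_finite_image (f := fun γ => (γ.1 : Fin n → Fin n → ℤ))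
    (hfin.subset ?_) (fun a _ b _ h => Subtype.ext h)
  rintro _ ⟨γ, hγ, rfl⟩
  refine ⟨fun i j => ?_, fun i j => ?_⟩
  · have := (abs_le.1 (key γ hγ i j)).1
    have h4 := Int.le_ceil R
    exact_mod_cast (neg_le_neg h4).trans this
  · have := (abs_le.1 (key γ hγ i j)).2
    exact_mod_cast this.trans (Int.le_ceil R)

/-- Orbit weights exist: put equal weights on the finitely many orbit points of least height. -/
theorem exists_isOrbitWeight (n : ℕ) :
    ∃ ψ : Matrix (Fin n) (Fin n) ℝ → ℝ≥0∞, IsOrbitWeight ψ := by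
  classical
  let N : ℕ → Matrix (Fin n) (Fin n) ℝ → ℝ≥0∞ := fun k B =>
    ∑' γ : Matrix.SpecialLinearGroup (Fin n) ℤ, if height (toR γ * B) ≤ k then 1 else 0
  let ψ : Matrix (Fin n) (Fin n) ℝ → ℝ≥0∞ := fun B =>
    if ∀ γ, height B ≤ height (toR γ * B) then
      (∑' γ : Matrix.SpecialLinearGroup (Fin n) ℤ,
        if height (toR γ * B) ≤ height B then 1 else 0)⁻¹ else 0
  have hh : ∀ γ : Matrix.SpecialLinearGroup (Fin n) ℤ,
      Measurable fun B : Matrix (Fin n) (Fin n) ℝ => height (toR γ * B) :=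
    fun γ => measurable_height.comp (measurable_toR_mul γ)
  refine ⟨ψ, ?_, ?_⟩
  · refine Measurable.ite ?_ ?_ measurable_const
    · simp only [Set.ofPred_forall]
      exact MeasurableSet.iInter fun γ => measurableSet_le measurable_height (hh γ)
    · refine Measurable.inv (Measurable.tsum fun γ => ?_)
      exact Measurable.ite (measurableSet_le (hh γ) measurable_height) measurable_const
        measurable_const
  · intro B hB
    obtain ⟨γ₀, hγ₀⟩ : ∃ γ₀ : Matrix.SpecialLinearGroup (Fin n) ℤ,
        ∀ γ, height (toR γ₀ * B) ≤ height (toR γ * B) := by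
      obtain ⟨γ₀, -, h⟩ := WellFounded.has_min (measure fun γ :
        Matrix.SpecialLinearGroup (Fin n) ℤ => height (toR γ * B)).wf Set.univ ⟨1, trivial⟩
      exact ⟨γ₀, fun γ => not_lt.1 (h γ trivial)⟩
    set k := height (toR γ₀ * B)
    have hN : N k B ≠ ∞ := by
      have hf := finite_height_le hB k
      simp only [N]
      rw [tsum_eq_sum (s := hf.toFinset) (fun γ hγ => if_neg (by simpa using hγ))]
      exact ENNReal.sum_ne_top.2 fun _ _ => by split_ifs <;> simp
    have hN0 : N k B ≠ 0 := by
      intro h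
      have := ENNReal.tsum_eq_zero.1 h γ₀
      simp [k] at this
    have hre : ∀ (γ : Matrix.SpecialLinearGroup (Fin n) ℤ) (l : ℕ),
        N l (toR γ * B) = N l B := by
      intro γ l
      simp only [N, ← Matrix.mul_assoc, ← toR_mul]
      exact (Equiv.mulRight γ).tsum_eq (fun δ => if height (toR δ * B) ≤ l then (1 : ℝ≥0∞) else 0)
    have hψ : ∀ γ, ψ (toR γ * B) = (if height (toR γ * B) ≤ k then 1 else 0) * (N k B)⁻¹ := by
      intro γ
      have hiff : (∀ δ, height (toR γ * B) ≤ height (toR δ * (toR γ * B))) ↔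
          height (toR γ * B) ≤ k := by
        constructor
        · intro h
          have := h (γ₀ * γ⁻¹)
          rwa [← Matrix.mul_assoc, ← toR_mul, inv_mul_cancel_right] at this
        · intro h δ
          rw [← Matrix.mul_assoc, ← toR_mul]
          exact h.trans (hγ₀ _)
      by_cases h : height (toR γ * B) ≤ k
      · have he : height (toR γ * B) = k := le_antisymm h (hγ₀ γ)
        have h1 : ψ (toR γ * B) = (N (height (toR γ * B)) (toR γ * B))⁻¹ :=
          if_pos (hiff.2 h)
        rw [h1, he, hre, if_pos le_rfl, one_mul]
      · rw [if_neg h, zero_mul]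
        exact if_neg (mt hiff.1 h)
    simp_rw [hψ, ENNReal.tsum_mul_right]
    exact ENNReal.mul_inv_cancel hN0 hN

/-- The unfolding identity: integrating an orbit sum against an orbit weight gives the integral over
the whole cone, by left invariance of the measure. -/
theorem IsOrbitWeight.lintegral_mul_tsum {n : ℕ} {ψ : Matrix (Fin n) (Fin n) ℝ → ℝ≥0∞}
    (hψ : IsOrbitWeight ψ) {Φ : Matrix (Fin n) (Fin n) ℝ → ℝ≥0∞} (hΦ : Measurable Φ) :
    ∫⁻ B, ψ B * ∑' γ, Φ (toR γ * B) ∂(coneMeasure n) = ∫⁻ B, Φ B ∂(coneMeasure n) := by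
  have hm := hψ.measurable
  have h1 : ∀ γ : Matrix.SpecialLinearGroup (Fin n) ℤ,
      ∫⁻ B, ψ B * Φ (toR γ * B) ∂(coneMeasure n) =
        ∫⁻ B, ψ (toR γ⁻¹ * B) * Φ B ∂(coneMeasure n) := by
    intro γ
    rw [← (coneMeasure_mul_left (det_toR γ)).lintegral_comp
      (f := fun B => ψ (toR γ⁻¹ * B) * Φ B) (by fun_prop)]
    simp [← Matrix.mul_assoc, ← toR_mul, toR_one]
  simp_rw [← ENNReal.tsum_mul_left]
  rw [lintegral_tsum (fun γ => by fun_prop)]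
  simp_rw [h1]
  rw [← lintegral_tsum (fun γ => by fun_prop)]
  refine lintegral_congr_ae ?_
  filter_upwards [ae_coneMeasure] with B hB
  have h2 := (Equiv.inv (Matrix.SpecialLinearGroup (Fin n) ℤ)).tsum_eq (fun γ => ψ (toR γ * B))
  simp only [Equiv.inv_apply] at h2
  rw [ENNReal.tsum_mul_right, h2, hψ.tsum_eq_one B hB.1, one_mul]

/-! ### The stabiliser of a coordinate vector -/

/-- An upper triangular matrix with first row `u`; it has determinant one when `u 0 ≠ 0`. -/
noncomputable def frame {k : ℕ} (u : Fin (k + 2) → ℝ) : Matrix (Fin (k + 2)) (Fin (k + 2)) ℝ :=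
  Matrix.of fun i j => if i = 0 then u j else if i = j then (if i = 1 then (u 0)⁻¹ else 1) else 0

theorem det_frame {k : ℕ} {u : Fin (k + 2) → ℝ} (hu : u 0 ≠ 0) : (frame u).det = 1 := by
  rw [Matrix.det_of_isUpperTriangular]
  · rw [Fin.prod_univ_succ, Fin.prod_univ_succ]
    have h1 : ∀ i : Fin k, frame u i.succ.succ i.succ.succ = 1 := by
      intro i
      have : i.succ.succ ≠ 1 := by simp [Fin.ext_iff]
      simp [frame, this]
    simp only [h1, Finset.prod_const_one, mul_one]
    simp [frame, hu]
  · intro i j hij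
    have hi : i ≠ 0 := fun h => by subst h; exact absurd hij (by simp)
    have hij' : i ≠ j := (ne_of_lt hij).symm
    simp [frame, hi, hij']

theorem frame_zero {k : ℕ} (u : Fin (k + 2) → ℝ) : frame u 0 = u := by
  ext j; simp [frame]

theorem measurable_frame {k : ℕ} : Measurable (frame (k := k)) := by
  refine measurable_pi_lambda _ fun i => measurable_pi_lambda _ fun j => ?_
  change Measurable fun u : Fin (k + 2) → ℝ =>
    if i = 0 then u j else if i = j then (if i = 1 then (u 0)⁻¹ else 1) else 0
  split_ifs <;> fun_prop

/-- The bordered matrix `[[1, 0], [x, B]]`. -/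
def border {R : Type*} [CommRing R] {m : ℕ} (x : Fin m → R) (B : Matrix (Fin m) (Fin m) R) :
    Matrix (Fin (m + 1)) (Fin (m + 1)) R :=
  Matrix.of (Fin.cons (Pi.single 0 1) fun i => Fin.cons (x i) (B i))

section border
variable {R : Type*} [CommRing R] {m : ℕ} (x : Fin m → R) (B : Matrix (Fin m) (Fin m) R)

theorem border_zero : border x B 0 = Pi.single 0 1 := rfl
theorem border_zero_zero : border x B 0 0 = 1 := rfl
theorem border_zero_succ (j : Fin m) : border x B 0 j.succ = 0 := by
  rw [border_zero]; simp
theorem border_succ_zero (i : Fin m) : border x B i.succ 0 = x i := rfl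
theorem border_succ_succ (i j : Fin m) : border x B i.succ j.succ = B i j := rfl

theorem det_border : (border x B).det = B.det := by
  rw [Matrix.det_succ_row_zero, Fin.sum_univ_succ]
  simp only [border_zero_succ, border_zero_zero]
  simp only [Fin.val_zero, pow_zero, one_mul, mul_zero, zero_mul, Finset.sum_const_zero, add_zero]
  congr 1

theorem border_mul (y : Fin m → R) (C : Matrix (Fin m) (Fin m) R) :
    border y C * border x B = border (y + C *ᵥ x) (C * B) := by
  ext i j
  rw [Matrix.mul_apply, Fin.sum_univ_succ]
  refine Fin.cases ?_ (fun i => ?_) i <;> refine Fin.cases ?_ (fun j => ?_) j <;>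
    simp [border_zero_zero, border_zero_succ, border_succ_zero, border_succ_succ, Matrix.mul_apply,
      Matrix.mulVec, dotProduct]

theorem eq_border {M : Matrix (Fin (m + 1)) (Fin (m + 1)) R} (h : M 0 = Pi.single 0 1) :
    M = border (fun i => M i.succ 0) (Matrix.of fun i j => M i.succ j.succ) := by
  ext i j
  refine Fin.cases ?_ (fun i => ?_) i
  · rw [h, border_zero]
  · refine Fin.cases ?_ (fun j => ?_) j
    · rfl
    · rfl

end border

theorem mul_row {m n : ℕ} (A : Matrix (Fin m) (Fin m) ℝ) (B : Matrix (Fin m) (Fin n) ℝ)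
    (i : Fin m) : (A * B) i = A i ᵥ* B := Matrix.mul_apply_eq_vecMul A B i

/-- The coordinates of the rows of `B` in the frame of its first row. The adjugate stands for the
inverse: the two agree when `B 0 0 ≠ 0`, since the frame then has determinant one. -/
noncomputable def coords {k : ℕ} (B : Matrix (Fin (k + 2)) (Fin (k + 2)) ℝ) :
    Matrix (Fin (k + 2)) (Fin (k + 2)) ℝ :=
  B * (frame (B 0)).adjugate

theorem measurable_coords {k : ℕ} : Measurable (coords (k := k)) := by
  have h1 : Continuous fun p : Matrix (Fin (k + 2)) (Fin (k + 2)) ℝ ×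
      Matrix (Fin (k + 2)) (Fin (k + 2)) ℝ => p.1 * p.2.adjugate :=
    continuous_fst.matrix_mul continuous_snd.matrix_adjugate
  exact h1.measurable.comp
    (measurable_id.prodMk (measurable_frame.comp (measurable_pi_apply 0)))

theorem coords_zero {k : ℕ} {B : Matrix (Fin (k + 2)) (Fin (k + 2)) ℝ} (h : B 0 0 ≠ 0) :
    coords B 0 = Pi.single 0 1 := by
  have h2 : frame (B 0) * (frame (B 0)).adjugate = 1 := by
    rw [Matrix.mul_adjugate, det_frame h, one_smul]
  have h3 := congrFun h2 0
  rw [mul_row, frame_zero] at h3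
  rw [coords, mul_row, h3]
  ext j; simp [Matrix.one_apply, Pi.single_apply, eq_comm]

theorem coords_mul {k : ℕ} {A B : Matrix (Fin (k + 2)) (Fin (k + 2)) ℝ}
    (hA : A 0 = Pi.single 0 1) : coords (A * B) = A * coords B := by
  have : (A * B) 0 = B 0 := by rw [mul_row, hA, Matrix.single_one_vecMul]; rfl
  rw [coords, coords, this, Matrix.mul_assoc]

theorem det_coords {k : ℕ} {B : Matrix (Fin (k + 2)) (Fin (k + 2)) ℝ} (h : B 0 0 ≠ 0) :
    (coords B).det = B.det := by
  rw [coords, Matrix.det_mul, Matrix.det_adjugate, det_frame h, one_pow, mul_one]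

theorem coords_border_mul {k : ℕ} (x : Fin (k + 1) → ℝ) (B : Matrix (Fin (k + 1)) (Fin (k + 1)) ℝ)
    {u : Fin (k + 2) → ℝ} (hu : u 0 ≠ 0) : coords (border x B * frame u) = border x B := by
  have h0 : (border x B * frame u) 0 = u := by
    rw [mul_row, border_zero, Matrix.single_one_vecMul]; exact frame_zero u
  rw [coords, h0, Matrix.mul_assoc, Matrix.mul_adjugate, det_frame hu, one_smul, mul_one]

/-- The half open unit cube `[0, 1)^m`. -/
def unitCube (m : ℕ) : Set (Fin m → ℝ) := Set.pi Set.univ fun _ => Set.Ico 0 1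

theorem measurableSet_unitCube {m : ℕ} : MeasurableSet (unitCube m) :=
  MeasurableSet.univ_pi fun _ => measurableSet_Ico

theorem volume_unitCube {m : ℕ} : volume (unitCube m) = 1 := by
  rw [unitCube, volume_pi_pi]; simp

/-- The translates of the unit cube by integer vectors tile the space. -/
theorem tsum_unitCube {m : ℕ} (z : Fin m → ℝ) :
    ∑' p : Fin m → ℤ, (unitCube m).indicator (1 : (Fin m → ℝ) → ℝ≥0∞)
      ((fun i => (p i : ℝ)) + z) = 1 := by
  have hiff : ∀ p : Fin m → ℤ, ((fun i => (p i : ℝ)) + z) ∈ unitCube m ↔ p = fun i => -⌊z i⌋ := by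
    intro p
    simp only [unitCube, Set.mem_pi, Set.mem_univ, true_imp_iff, Pi.add_apply, Set.mem_Ico,
      funext_iff]
    refine forall_congr' fun i => ?_
    rw [eq_neg_iff_add_eq_zero, ← Int.floor_intCast_add, Int.floor_eq_zero_iff, Set.mem_Ico]
  rw [tsum_eq_single fun i => -⌊z i⌋]
  · rw [Set.indicator_of_mem ((hiff _).2 rfl)]; rfl
  · intro p hp
    exact Set.indicator_of_notMem (mt (hiff p).1 hp) _

/-- The weight on matrices of size `k + 2` induced by a weight on matrices of size `k + 1`; its sum
over the orbits of the stabiliser of the first coordinate vector is `1`. -/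
noncomputable def borderWeight {k : ℕ} (ψ : Matrix (Fin (k + 1)) (Fin (k + 1)) ℝ → ℝ≥0∞)
    (B : Matrix (Fin (k + 2)) (Fin (k + 2)) ℝ) : ℝ≥0∞ :=
  (unitCube (k + 1)).indicator 1 (fun i => coords B i.succ 0) *
    ψ (Matrix.of fun i j => coords B i.succ j.succ)

theorem measurable_borderWeight {k : ℕ} {ψ : Matrix (Fin (k + 1)) (Fin (k + 1)) ℝ → ℝ≥0∞}
    (hψ : Measurable ψ) : Measurable (borderWeight ψ) := by
  have h1 : Measurable fun B : Matrix (Fin (k + 2)) (Fin (k + 2)) ℝ =>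
      (fun i : Fin (k + 1) => coords B i.succ 0) :=
    measurable_pi_lambda _ fun i =>
      (measurable_pi_apply 0).comp ((measurable_pi_apply i.succ).comp measurable_coords)
  have h2 : Measurable fun B : Matrix (Fin (k + 2)) (Fin (k + 2)) ℝ =>
      (Matrix.of fun i j : Fin (k + 1) => coords B i.succ j.succ) :=
    measurable_pi_lambda _ fun i => measurable_pi_lambda _ fun j =>
      (measurable_pi_apply j.succ).comp ((measurable_pi_apply i.succ).comp measurable_coords)
  exact ((measurable_one.indicator measurableSet_unitCube).comp h1).mul (hψ.comp h2)

/-- The stabiliser of the first coordinate row in `SL_{m+1}(ℤ)` is `SL_m(ℤ) ⋉ ℤ^m`. -/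
def stabEquiv (m : ℕ) : Matrix.SpecialLinearGroup (Fin m) ℤ × (Fin m → ℤ) ≃
    {γ : Matrix.SpecialLinearGroup (Fin (m + 1)) ℤ // γ.1 0 = Pi.single 0 1} where
  toFun p := ⟨⟨border p.2 p.1.1, by rw [det_border, p.1.2]⟩, border_zero _ _⟩
  invFun γ := (⟨Matrix.of fun i j => γ.1.1 i.succ j.succ, by
    rw [← det_border (fun i => γ.1.1 i.succ 0), ← eq_border γ.2, γ.1.2]⟩, fun i => γ.1.1 i.succ 0)
  left_inv _ := rfl
  right_inv γ := Subtype.ext (Subtype.ext (eq_border γ.2).symm)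

theorem toR_stabEquiv {m : ℕ} (p : Matrix.SpecialLinearGroup (Fin m) ℤ × (Fin m → ℤ)) :
    toR (stabEquiv m p).1 = border (fun i => (p.2 i : ℝ)) (toR p.1) := by
  ext i j
  rw [toR_apply]
  change ((border p.2 p.1.1 i j : ℤ) : ℝ) = _
  refine Fin.cases ?_ (fun i => ?_) i <;> refine Fin.cases ?_ (fun j => ?_) j
  · simp [border_zero_zero]
  · simp [border_zero_succ]
  · rfl
  · rfl

theorem borderWeight_border_mul {k : ℕ} (ψ : Matrix (Fin (k + 1)) (Fin (k + 1)) ℝ → ℝ≥0∞)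
    (y : Fin (k + 1) → ℝ) (C : Matrix (Fin (k + 1)) (Fin (k + 1)) ℝ)
    {B : Matrix (Fin (k + 2)) (Fin (k + 2)) ℝ} (h : B 0 0 ≠ 0) :
    borderWeight ψ (border y C * B) =
      (unitCube (k + 1)).indicator 1 (y + C *ᵥ fun i => coords B i.succ 0) *
        ψ (C * Matrix.of fun i j => coords B i.succ j.succ) := by
  have h1 : coords (border y C * B) = border (y + C *ᵥ fun i => coords B i.succ 0)
      (C * Matrix.of fun i j => coords B i.succ j.succ) := by
    rw [coords_mul (border_zero _ _), eq_border (coords_zero h), border_mul]; rfl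
  rw [borderWeight, h1]
  rfl

theorem tsum_stab_borderWeight {k : ℕ} {ψ : Matrix (Fin (k + 1)) (Fin (k + 1)) ℝ → ℝ≥0∞}
    (hψ : IsOrbitWeight ψ) {B : Matrix (Fin (k + 2)) (Fin (k + 2)) ℝ} (hB : 0 < B.det)
    (h : B 0 0 ≠ 0) :
    ∑' γ : {γ : Matrix.SpecialLinearGroup (Fin (k + 2)) ℤ // γ.1 0 = Pi.single 0 1},
      borderWeight ψ (toR γ.1 * B) = 1 := by
  rw [← (stabEquiv (k + 1)).tsum_eq]
  simp_rw [toR_stabEquiv, borderWeight_border_mul ψ _ _ h]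
  rw [ENNReal.summable.tsum_prod' fun _ => ENNReal.summable]
  simp_rw [ENNReal.tsum_mul_right, tsum_unitCube, one_mul]
  refine hψ.tsum_eq_one _ ?_
  rwa [← det_border (fun i => coords B i.succ 0), ← eq_border (coords_zero h), det_coords h]

/-- The vector `∑ i, q i • B i` of the lattice spanned by the rows of `B`. -/
noncomputable def latVec {m n : ℕ} (q : Fin m → ℤ) (B : Matrix (Fin m) (Fin n) ℝ) : Fin n → ℝ :=
  (fun i => (q i : ℝ)) ᵥ* B

theorem toR_mul_zero {n : ℕ} (γ : Matrix.SpecialLinearGroup (Fin (n + 1)) ℤ)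
    (B : Matrix (Fin (n + 1)) (Fin (n + 1)) ℝ) : (toR γ * B) 0 = latVec (γ.1 0) B :=
  mul_row _ _ _

/-- The matrices in `SL_{k+2}(ℤ)` with a prescribed first row form a coset of the stabiliser of the
first coordinate row, so their border weights sum to one. -/
theorem tsum_fiber_borderWeight {k : ℕ} {ψ : Matrix (Fin (k + 1)) (Fin (k + 1)) ℝ → ℝ≥0∞}
    (hψ : IsOrbitWeight ψ) {B : Matrix (Fin (k + 2)) (Fin (k + 2)) ℝ} (hB : 0 < B.det)
    (γ₀ : Matrix.SpecialLinearGroup (Fin (k + 2)) ℤ) (h : latVec (γ₀.1 0) B 0 ≠ 0) :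
    ∑' γ : {γ : Matrix.SpecialLinearGroup (Fin (k + 2)) ℤ // γ.1 0 = γ₀.1 0},
      borderWeight ψ (toR γ.1 * B) = 1 := by
  have hrow : ∀ a b : Matrix.SpecialLinearGroup (Fin (k + 2)) ℤ,
      (a * b).1 0 = a.1 0 ᵥ* b.1 := fun a b => Matrix.mul_apply_eq_vecMul _ _ _
  have hone : ∀ b : Matrix.SpecialLinearGroup (Fin (k + 2)) ℤ,
      b.1 0 = Pi.single 0 1 ᵥ* b.1 := fun b => by rw [Matrix.single_one_vecMul]; rfl
  have hid : (1 : Matrix.SpecialLinearGroup (Fin (k + 2)) ℤ).1 0 = Pi.single 0 1 := by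
    rw [hone, Matrix.SpecialLinearGroup.coe_one, Matrix.vecMul_one]
  let e : {γ : Matrix.SpecialLinearGroup (Fin (k + 2)) ℤ // γ.1 0 = Pi.single 0 1} ≃
      {γ : Matrix.SpecialLinearGroup (Fin (k + 2)) ℤ // γ.1 0 = γ₀.1 0} :=
    (Equiv.mulRight γ₀).subtypeEquiv fun γ => by
      rw [Equiv.coe_mulRight, hrow]
      constructor
      · intro h; rw [h, ← hone]
      · intro h
        have := congrArg (fun v => v ᵥ* (γ₀⁻¹).1) h
        simp only [← hrow] at this
        rwa [mul_inv_cancel_right, mul_inv_cancel, hid] at this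
  rw [← e.tsum_eq]
  have := tsum_stab_borderWeight hψ (B := toR γ₀ * B) (by rwa [det_toR_mul])
    (by rwa [toR_mul_zero])
  rw [← this]
  refine tsum_congr fun γ => ?_
  rw [← Matrix.mul_assoc, ← toR_mul]; rfl

/-! ### Primitive integer vectors -/

/-- A nonzero integer vector is a positive multiple of the first row of a matrix
in `SL_n(ℤ)`, `n ≥ 2`. -/
theorem exists_eq_nsmul_row {k : ℕ} {q : Fin (k + 2) → ℤ} (hq : q ≠ 0) :
    ∃ (j : ℕ) (γ : Matrix.SpecialLinearGroup (Fin (k + 2)) ℤ), q = (j + 1) • γ.1 0 := by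
  -- Smith normal form of `ℤ q` produces a basis with an element proportional to `q`.
  obtain ⟨n, S⟩ := (Submodule.span ℤ {q}).smithNormalForm (Pi.basisFun ℤ (Fin (k + 2)))
  let q' : Submodule.span ℤ {q} := ⟨q, Submodule.mem_span_singleton_self q⟩
  have hn : n = 1 := by
    have := Module.finrank_eq_card_basis S.bN
    rw [← (LinearEquiv.toSpanNonzeroSingleton ℤ _ q hq).finrank_eq, Module.finrank_self,
      Fintype.card_fin] at this
    exact this.symm
  subst hn
  obtain ⟨c, hc⟩ : ∃ c : ℤ, q = c • S.bM (S.f 0) := by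
    refine ⟨S.bN.repr q' 0 * S.a 0, ?_⟩
    have h1 := S.bN.sum_repr q'
    rw [Fin.sum_univ_one] at h1
    have h2 := congrArg Subtype.val h1
    rw [Submodule.coe_smul, S.snf, smul_smul] at h2
    exact h2.symm
  have hc0 : c ≠ 0 := by rintro rfl; exact hq (by simpa using hc)
  let b := S.bM.reindex (Equiv.swap (S.f 0) 0)
  have hb : b 0 = S.bM (S.f 0) := by simp [b]
  let M : Matrix (Fin (k + 2)) (Fin (k + 2)) ℤ := Matrix.of fun i => b i
  have hM : M.det * M.det = 1 := by
    have h1 : IsUnit ((Pi.basisFun ℤ (Fin (k + 2))).toMatrix b).det := by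
      rw [← Module.Basis.det_apply]; exact Module.Basis.isUnit_det _ _
    have h2 : (Pi.basisFun ℤ (Fin (k + 2))).toMatrix b = Mᵀ := by
      ext i j; simp [Module.Basis.toMatrix_apply, M]
    rw [h2, Matrix.det_transpose] at h1
    exact Int.isUnit_mul_self h1
  have hs : c.sign * c.sign = 1 := by
    rw [← Int.sign_mul, Int.sign_eq_one_of_pos (mul_self_pos.2 hc0)]
  -- The signs are corrected by a diagonal matrix.
  let D : Matrix (Fin (k + 2)) (Fin (k + 2)) ℤ := Matrix.diagonal
    (Fin.cons c.sign (Fin.cons (c.sign * M.det) fun _ => 1))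
  have hD : (D * M).det = 1 := by
    rw [Matrix.det_mul, Matrix.det_diagonal, Fin.prod_univ_succ, Fin.prod_univ_succ]
    simp only [Fin.cons_zero, Fin.cons_succ, Finset.prod_const_one, mul_one]
    rw [show c.sign * (c.sign * M.det) * M.det = (c.sign * c.sign) * (M.det * M.det) by ring,
      hs, hM, one_mul]
  refine ⟨c.natAbs - 1, ⟨D * M, hD⟩, ?_⟩
  have h1 : c.natAbs - 1 + 1 = c.natAbs := Nat.sub_add_cancel (Int.natAbs_pos.2 hc0)
  have h2 : (D * M) 0 = c.sign • S.bM (S.f 0) := by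
    ext j
    rw [← hb]
    simp [D, Matrix.diagonal_mul, M]
  change q = (c.natAbs - 1 + 1) • (D * M) 0
  rw [h1, h2, ← natCast_zsmul, smul_smul, mul_comm, Int.sign_mul_natAbs]
  exact hc

/-- The multiplier and the primitive vector are determined by their product: multiplying by `γ⁻¹`
turns the first row of `γ` into a coordinate row, so the multipliers divide each other. -/
theorem nsmul_row_injective {k : ℕ} {i j : ℕ}
    {γ δ : Matrix.SpecialLinearGroup (Fin (k + 2)) ℤ}
    (h : (i + 1) • γ.1 0 = (j + 1) • δ.1 0) : i = j ∧ γ.1 0 = δ.1 0 := by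
  have key : ∀ (i j : ℕ) (γ δ : Matrix.SpecialLinearGroup (Fin (k + 2)) ℤ),
      (i + 1) • γ.1 0 = (j + 1) • δ.1 0 → j + 1 ∣ i + 1 := by
    intro i j γ δ h
    have h1 := congrArg (fun v => (v ᵥ* (γ⁻¹).1) 0) h
    simp only [Matrix.smul_vecMul] at h1
    have h2 : (γ.1 0 ᵥ* (γ⁻¹).1) 0 = 1 := by
      have : (γ * γ⁻¹).1 0 = γ.1 0 ᵥ* (γ⁻¹).1 := Matrix.mul_apply_eq_vecMul _ _ _
      rw [← this, mul_inv_cancel]; rfl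
    rw [Pi.smul_apply, Pi.smul_apply, h2] at h1
    simp only [nsmul_eq_mul, mul_one] at h1
    exact Int.natCast_dvd_natCast.1 ⟨_, h1⟩
  have hij : i = j := by
    have := Nat.dvd_antisymm (key i j γ δ h) (key j i δ γ h.symm)
    omega
  subst hij
  refine ⟨rfl, ?_⟩
  ext l
  have := congrFun h l
  simp only [Pi.smul_apply, nsmul_eq_mul] at this
  exact mul_left_cancel₀ (by positivity) this

/-- A sum over nonzero integer vectors becomes a sum over positive multipliers and over `SL_n(ℤ)`,
once every primitive vector `p` carries weights of total mass one on the matrices with first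
row `p`. -/
theorem tsum_ne_zero_eq {k : ℕ} (a : (Fin (k + 2) → ℤ) → ℝ≥0∞)
    (w : Matrix.SpecialLinearGroup (Fin (k + 2)) ℤ → ℝ≥0∞)
    (hw : ∀ γ₀ : Matrix.SpecialLinearGroup (Fin (k + 2)) ℤ,
      ∑' γ : {γ : Matrix.SpecialLinearGroup (Fin (k + 2)) ℤ // γ.1 0 = γ₀.1 0}, w γ.1 = 1) :
    ∑' q : {q : Fin (k + 2) → ℤ // q ≠ 0}, a q =
      ∑' j : ℕ, ∑' γ : Matrix.SpecialLinearGroup (Fin (k + 2)) ℤ,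
        a ((j + 1) • γ.1 0) * w γ := by
  let P : Set (Fin (k + 2) → ℤ) :=
    Set.range fun γ : Matrix.SpecialLinearGroup (Fin (k + 2)) ℤ => γ.1 0
  have hne : ∀ γ : Matrix.SpecialLinearGroup (Fin (k + 2)) ℤ, γ.1 0 ≠ 0 := by
    intro γ h
    have := γ.2
    rw [Matrix.det_eq_zero_of_row_eq_zero 0 (fun j => congrFun h j)] at this
    exact zero_ne_one this
  let F : ℕ × P → {q : Fin (k + 2) → ℤ // q ≠ 0} := fun x => ⟨(x.1 + 1) • x.2.1, by
    obtain ⟨γ, hγ⟩ := x.2.2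
    rw [← hγ]
    intro h
    refine hne γ (funext fun l => ?_)
    have := congrFun h l
    simp only [Pi.smul_apply, nsmul_eq_mul, Pi.zero_apply, mul_eq_zero] at this
    exact this.resolve_left (by positivity)⟩
  have hF : Function.Bijective F := by
    constructor
    · rintro ⟨i, _, γ, rfl⟩ ⟨j, _, δ, rfl⟩ h
      obtain ⟨h1, h2⟩ := nsmul_row_injective (congrArg Subtype.val h)
      subst h1
      exact Prod.ext rfl (Subtype.ext h2)
    · rintro ⟨q, hq⟩
      obtain ⟨j, γ, h⟩ := exists_eq_nsmul_row hq
      exact ⟨(j, ⟨γ.1 0, γ, rfl⟩), Subtype.ext h.symm⟩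
  rw [← (Equiv.ofBijective F hF).tsum_eq, ENNReal.summable.tsum_prod' fun _ => ENNReal.summable]
  refine tsum_congr fun j => ?_
  let r : Matrix.SpecialLinearGroup (Fin (k + 2)) ℤ → P := fun γ => ⟨γ.1 0, γ, rfl⟩
  rw [← (Equiv.sigmaFiberEquiv r).tsum_eq, ENNReal.summable.tsum_sigma' fun _ => ENNReal.summable]
  refine tsum_congr ?_
  rintro ⟨_, γ₀, rfl⟩
  have h1 : ∀ c : {γ // r γ = ⟨γ₀.1 0, γ₀, rfl⟩},
      a ((j + 1) • (c.1 : Matrix.SpecialLinearGroup (Fin (k + 2)) ℤ).1 0) =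
        a ((j + 1) • γ₀.1 0) := fun c => by
    rw [show c.1.1 0 = γ₀.1 0 from congrArg Subtype.val c.2]
  simp only [Equiv.sigmaFiberEquiv_apply]
  simp_rw [h1, ENNReal.tsum_mul_left]
  have h2 := hw γ₀
  rw [← (Equiv.subtypeEquivRight (p := fun γ => r γ = ⟨γ₀.1 0, γ₀, rfl⟩)
    (q := fun γ => γ.1 0 = γ₀.1 0) fun γ => Subtype.ext_iff).tsum_eq] at h2
  simp only [Equiv.subtypeEquivRight_apply_coe] at h2
  rw [h2, mul_one]
  rfl

/-! ### Coordinates relative to the first row -/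

theorem measurePreserving_cons_rows (m n : ℕ) :
    MeasurePreserving (fun p : (Fin m → ℝ) × Matrix (Fin m) (Fin n) ℝ =>
      (Matrix.of fun i => Fin.cons (p.1 i) (p.2 i) : Matrix (Fin m) (Fin (n + 1)) ℝ)) := by
  have h1 : MeasurePreserving (fun p : Fin m → ℝ × (Fin n → ℝ) =>
      (fun i => (MeasurableEquiv.piFinSuccAbove (fun _ : Fin (n + 1) => ℝ) 0).symm (p i))) :=
    volume_preserving_pi fun _ : Fin m =>
      (volume_preserving_piFinSuccAbove (fun _ : Fin (n + 1) => ℝ) 0).symm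
  have h2 := (volume_measurePreserving_arrowProdEquivProdArrow ℝ (Fin n → ℝ) (Fin m)).symm
  convert! h1.comp h2 using 1
  funext p
  refine funext fun i => funext fun j => ?_
  exact Fin.cases rfl (fun j => rfl) j

theorem measurePreserving_cons_row (m n : ℕ) :
    MeasurePreserving (fun p : (Fin n → ℝ) × Matrix (Fin m) (Fin n) ℝ =>
      (Matrix.of (Fin.cons p.1 p.2) : Matrix (Fin (m + 1)) (Fin n) ℝ)) := by
  have := (volume_preserving_piFinSuccAbove (fun _ : Fin (m + 1) => (Fin n → ℝ)) 0).symm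
  convert! this using 1
  funext p
  refine funext fun i => ?_
  exact Fin.cases rfl (fun j => rfl) i

theorem border_mul_frame {k : ℕ} (x : Fin (k + 1) → ℝ) (B : Matrix (Fin (k + 1)) (Fin (k + 1)) ℝ)
    (u : Fin (k + 2) → ℝ) :
    border x B * frame u =
      Matrix.of (Fin.cons u ((Matrix.of fun i => Fin.cons (x i) (B i)) * frame u)) := by
  ext i j
  refine Fin.cases ?_ (fun i => ?_) i
  · rw [mul_row, border_zero, Matrix.single_one_vecMul]
    exact congrFun (frame_zero u) j
  · rfl

theorem ae_zero_ne_zero (n : ℕ) : ∀ᵐ u : Fin (n + 1) → ℝ, u 0 ≠ 0 := by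
  rw [ae_iff]
  simp only [not_not]
  exact Measure.pi_hyperplane (fun _ : Fin (n + 1) => (volume : Measure ℝ)) 0 0

theorem measurable_border {m : ℕ} :
    Measurable fun p : (Fin m → ℝ) × Matrix (Fin m) (Fin m) ℝ => border p.1 p.2 := by
  have : Continuous fun p : (Fin m → ℝ) × Matrix (Fin m) (Fin m) ℝ => border p.1 p.2 := by
    refine continuous_matrix fun i j => ?_
    refine Fin.cases ?_ (fun i => ?_) i <;> refine Fin.cases ?_ (fun j => ?_) j
    · simp only [border_zero_zero]; fun_prop
    · simp only [border_zero_succ]; fun_prop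
    · simp only [border_succ_zero]; fun_prop
    · simp only [border_succ_succ]; fun_prop
  exact this.measurable

/-- Lebesgue measure on square matrices in the coordinates given by the first row `u` and the
remaining rows expressed in the frame of `u`. -/
theorem lintegral_eq_border {k : ℕ} {K : Matrix (Fin (k + 2)) (Fin (k + 2)) ℝ → ℝ≥0∞}
    (hK : Measurable K) :
    ∫⁻ B, K B = ∫⁻ u : Fin (k + 2) → ℝ, ∫⁻ B : Matrix (Fin (k + 1)) (Fin (k + 1)) ℝ,
      ∫⁻ x : Fin (k + 1) → ℝ, K (border x B * frame u) := by
  have h1 := measurePreserving_cons_row (k + 1) (k + 2)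
  rw [← h1.lintegral_comp hK]
  refine (lintegral_prod _ (hK.comp h1.measurable).aemeasurable).trans ?_
  refine lintegral_congr_ae ?_
  filter_upwards [ae_zero_ne_zero (k + 1)] with u hu
  have h2 : Measurable fun R : Matrix (Fin (k + 1)) (Fin (k + 2)) ℝ =>
      K (Matrix.of (Fin.cons u R)) := hK.comp (h1.measurable.comp measurable_prodMk_left)
  have h3 := measurePreserving_mul_right (m := k + 1) (det_frame hu)
  have h4 := measurePreserving_cons_rows (k + 1) (k + 1)
  have h5 : Measurable fun p : (Fin (k + 1) → ℝ) × Matrix (Fin (k + 1)) (Fin (k + 1)) ℝ =>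
      K (border p.1 p.2 * frame u) :=
    hK.comp ((measurePreserving_mul_right (det_frame hu)).measurable.comp measurable_border)
  change ∫⁻ R : Matrix (Fin (k + 1)) (Fin (k + 2)) ℝ, K (Matrix.of (Fin.cons u R)) = _
  refine (h3.lintegral_comp h2).symm.trans
    ((h4.lintegral_comp (h2.comp h3.measurable)).symm.trans ?_)
  simp_rw [Function.comp_def, ← border_mul_frame]
  exact lintegral_prod_symm _ h5.aemeasurable

/-- The matrix rescaled to determinant one; meaningful for positive determinant. -/
noncomputable def unimod {n : ℕ} (B : Matrix (Fin n) (Fin n) ℝ) : Matrix (Fin n) (Fin n) ℝ :=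
  (B.det ^ (-(n : ℝ)⁻¹)) • B

theorem measurable_unimod {n : ℕ} : Measurable (unimod (n := n)) := by
  refine measurable_pi_lambda _ fun i => measurable_pi_lambda _ fun j => ?_
  change Measurable fun B : Matrix (Fin n) (Fin n) ℝ => (B.det ^ (-(n : ℝ)⁻¹)) * B i j
  have h : Measurable fun B : Matrix (Fin n) (Fin n) ℝ => B i j :=
    (measurable_pi_apply j).comp (measurable_pi_apply i)
  exact (measurable_det.pow_const _).mul h

theorem unimod_mul {n : ℕ} {A B : Matrix (Fin n) (Fin n) ℝ} (hA : A.det = 1) :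
    unimod (A * B) = A * unimod B := by
  simp [unimod, Matrix.det_mul, hA]

theorem unimod_mul_right {n : ℕ} {A B : Matrix (Fin n) (Fin n) ℝ} (hA : A.det = 1) :
    unimod (B * A) = unimod B * A := by
  simp [unimod, Matrix.det_mul, hA]

theorem rpow_neg_inv_pow {n : ℕ} (hn : n ≠ 0) {t : ℝ} (ht : 0 < t) :
    (t ^ (-(n : ℝ)⁻¹)) ^ n = t⁻¹ := by
  rw [← Real.rpow_natCast, ← Real.rpow_mul ht.le, neg_mul,
    inv_mul_cancel₀ (Nat.cast_ne_zero.2 hn), Real.rpow_neg_one]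

theorem det_unimod {n : ℕ} (hn : n ≠ 0) {B : Matrix (Fin n) (Fin n) ℝ} (hB : 0 < B.det) :
    (unimod B).det = 1 := by
  rw [unimod, Matrix.det_smul, Fintype.card_fin, rpow_neg_inv_pow hn hB, inv_mul_cancel₀ hB.ne']

theorem lintegral_comp_smul_pi {n : ℕ} {H : (Fin n → ℝ) → ℝ≥0∞} (hH : Measurable H) {r : ℝ}
    (hr : 0 < r) : ∫⁻ u, H (r • u) = ENNReal.ofReal (r ^ n)⁻¹ * ∫⁻ u, H u := by
  have h := Measure.map_addHaar_smul (volume : Measure (Fin n → ℝ)) hr.ne'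
  rw [← lintegral_map hH (measurable_const_smul r), h, lintegral_smul_measure,
    Module.finrank_fin_fun, abs_of_pos (by positivity)]
  rfl

/-- The contribution of the primitive vectors to Siegel's formula. In the coordinates of
`lintegral_eq_border` the column `x` integrates to one and the first row `u` separates; the Jacobian
of the rescaling of `u` is the factor `det B`. -/
theorem lintegral_row_mul_borderWeight {k : ℕ}
    {ψ : Matrix (Fin (k + 1)) (Fin (k + 1)) ℝ → ℝ≥0∞} (hψ : Measurable ψ)
    {H : (Fin (k + 2) → ℝ) → ℝ≥0∞} (hH : Measurable H) :
    ∫⁻ B, H (unimod B 0) * borderWeight ψ B ∂(coneMeasure (k + 2)) =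
      (∫⁻ B, ENNReal.ofReal B.det * ψ B ∂(coneMeasure (k + 1))) * ∫⁻ u, H u := by
  have hm : Measurable fun B : Matrix (Fin (k + 2)) (Fin (k + 2)) ℝ =>
      H (unimod B 0) * borderWeight ψ B :=
    (hH.comp ((measurable_pi_apply 0).comp measurable_unimod)).mul (measurable_borderWeight hψ)
  rw [coneMeasure, ← lintegral_indicator measurableSet_detCone,
    lintegral_eq_border (hm.indicator measurableSet_detCone)]
  let s : Matrix (Fin (k + 1)) (Fin (k + 1)) ℝ → ℝ := fun B => B.det ^ (-((k + 2 : ℕ) : ℝ)⁻¹)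
  have hs : Measurable s := measurable_det.pow_const _
  -- The integrand in the new coordinates, up to the indicator of the unit cube.
  let G : (Fin (k + 2) → ℝ) → Matrix (Fin (k + 1)) (Fin (k + 1)) ℝ → ℝ≥0∞ := fun u B =>
    (detCone (k + 1)).indicator ψ B * H (s B • u)
  have hG : Measurable (Function.uncurry G) := by
    refine Measurable.mul ((hψ.indicator measurableSet_detCone).comp measurable_snd) (hH.comp ?_)
    exact (hs.comp measurable_snd).smul measurable_fst
  calc _ = ∫⁻ u : Fin (k + 2) → ℝ, ∫⁻ B : Matrix (Fin (k + 1)) (Fin (k + 1)) ℝ, G u B := by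
        refine lintegral_congr_ae ?_
        filter_upwards [ae_zero_ne_zero (k + 1)] with u hu
        refine lintegral_congr fun B => ?_
        have h1 : ∀ x : Fin (k + 1) → ℝ,
            (detCone (k + 2)).indicator
              (fun B => H (unimod B 0) * borderWeight ψ B) (border x B * frame u) =
            (unitCube (k + 1)).indicator 1 x * G u B := by
          intro x
          have hd : (border x B * frame u).det = B.det := by
            rw [Matrix.det_mul, det_border, det_frame hu, mul_one]
          have h0 : (border x B * frame u) 0 = u := by
            rw [mul_row, border_zero, Matrix.single_one_vecMul]; exact frame_zero u
          have h2 : unimod (border x B * frame u) 0 = s B • u := by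
            rw [unimod, hd]
            change s B • ((border x B * frame u) 0) = _
            rw [h0]
          have h3 : borderWeight ψ (border x B * frame u) =
              (unitCube (k + 1)).indicator 1 x * ψ B := by
            rw [borderWeight, coords_border_mul x B hu]; rfl
          have hC : border x B * frame u ∈ detCone (k + 2) ↔ B ∈ detCone (k + 1) := by
            simp only [detCone, Set.mem_ofPred_eq, hd]
          by_cases hB : B ∈ detCone (k + 1)
          · rw [Set.indicator_of_mem (hC.2 hB), h2, h3]
            simp only [G]
            rw [Set.indicator_of_mem (s := detCone (k + 1)) hB]
            ring
          · rw [Set.indicator_of_notMem (mt hC.1 hB)]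
            simp only [G]
            rw [Set.indicator_of_notMem (s := detCone (k + 1)) hB]
            simp
        simp_rw [h1]
        rw [lintegral_mul_const _ (measurable_one.indicator measurableSet_unitCube),
          lintegral_indicator_one measurableSet_unitCube, volume_unitCube, one_mul]
    _ = ∫⁻ B : Matrix (Fin (k + 1)) (Fin (k + 1)) ℝ, ∫⁻ u : Fin (k + 2) → ℝ, G u B :=
        lintegral_lintegral_swap hG.aemeasurable
    _ = ∫⁻ B : Matrix (Fin (k + 1)) (Fin (k + 1)) ℝ,
          (detCone (k + 1)).indicator
            (fun B => ENNReal.ofReal B.det * ψ B) B * ∫⁻ u, H u := by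
        refine lintegral_congr fun B => ?_
        by_cases hB : B ∈ detCone (k + 1)
        · have hsB : 0 < s B := Real.rpow_pos_of_pos hB.1 _
          have h1 : ∀ u, G u B = ψ B * H (s B • u) := fun u => by
            simp only [G]; rw [Set.indicator_of_mem hB]
          simp_rw [h1]
          rw [lintegral_const_mul (ψ B) (f := fun u => H (s B • u))
              (hH.comp (measurable_const_smul (s B))),
            lintegral_comp_smul_pi hH hsB, rpow_neg_inv_pow (by omega) hB.1, inv_inv,
            Set.indicator_of_mem hB]
          ring
        · have h1 : ∀ u, G u B = 0 := fun u => by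
            simp only [G]; rw [Set.indicator_of_notMem hB, zero_mul]
          simp_rw [h1]
          rw [Set.indicator_of_notMem hB]
          simp
    _ = _ := by
        have h1 : Measurable fun B : Matrix (Fin (k + 1)) (Fin (k + 1)) ℝ =>
            ENNReal.ofReal B.det * ψ B :=
          (ENNReal.measurable_ofReal.comp measurable_det).mul hψ
        rw [lintegral_mul_const _ (h1.indicator measurableSet_detCone),
          lintegral_indicator measurableSet_detCone]
        rfl

/-! ### Siegel's formula and finite covolume -/

theorem measurable_latVec {m n : ℕ} (q : Fin m → ℤ) :
    Measurable fun B : Matrix (Fin m) (Fin n) ℝ => latVec q B := by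
  have : Continuous fun B : Matrix (Fin m) (Fin n) ℝ => latVec q B :=
    continuous_const.matrix_vecMul continuous_id
  exact this.measurable

theorem latVec_nsmul {m n : ℕ} (q : Fin m → ℤ) (j : ℕ) (B : Matrix (Fin m) (Fin n) ℝ) :
    latVec ((j + 1) • q) B = ((j : ℝ) + 1) • latVec q B := by
  rw [latVec, latVec, ← Matrix.smul_vecMul]
  congr 1
  ext i
  simp

/-- The primitive vectors of almost every lattice avoid the hyperplane on which the frame
degenerates. -/
theorem ae_latVec_row_ne_zero (n : ℕ) : ∀ᵐ B ∂(coneMeasure (n + 1)),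
    ∀ γ : Matrix.SpecialLinearGroup (Fin (n + 1)) ℤ, latVec (γ.1 0) B 0 ≠ 0 := by
  rw [ae_all_iff]
  intro γ
  have h0 : ∀ᵐ B : Matrix (Fin (n + 1)) (Fin (n + 1)) ℝ, B 0 0 ≠ 0 :=
    (Measure.quasiMeasurePreserving_eval (fun _ : Fin (n + 1) =>
      (volume : Measure (Fin (n + 1) → ℝ))) 0).ae (ae_zero_ne_zero n)
  have h1 : ∀ᵐ B ∂(coneMeasure (n + 1)), B 0 0 ≠ 0 := ae_restrict_of_ae h0
  filter_upwards [(coneMeasure_mul_left (det_toR γ)).quasiMeasurePreserving.ae h1] with B hB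
  rwa [toR_mul_zero] at hB

/-- Siegel's formula up to the value of the constant: unfolding along the primitive vectors,
followed by summation over their positive multiples. -/
theorem lintegral_mul_tsum_latVec {k : ℕ} {ψ : Matrix (Fin (k + 2)) (Fin (k + 2)) ℝ → ℝ≥0∞}
    (hψ : IsOrbitWeight ψ) {ψ' : Matrix (Fin (k + 1)) (Fin (k + 1)) ℝ → ℝ≥0∞}
    (hψ' : IsOrbitWeight ψ') {H : (Fin (k + 2) → ℝ) → ℝ≥0∞} (hH : Measurable H) :
    ∫⁻ B, ψ B * ∑' q : {q : Fin (k + 2) → ℤ // q ≠ 0}, H (latVec q.1 (unimod B))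
      ∂(coneMeasure (k + 2)) =
    ((∑' j : ℕ, ENNReal.ofReal (((j : ℝ) + 1) ^ (k + 2))⁻¹) *
      ∫⁻ B, ENNReal.ofReal B.det * ψ' B ∂(coneMeasure (k + 1))) * ∫⁻ u, H u := by
  let Φ : ℕ → Matrix (Fin (k + 2)) (Fin (k + 2)) ℝ → ℝ≥0∞ := fun j B =>
    H (((j : ℝ) + 1) • unimod B 0) * borderWeight ψ' B
  have hHj : ∀ j : ℕ, Measurable fun u : Fin (k + 2) → ℝ => H (((j : ℝ) + 1) • u) := fun j =>
    hH.comp (measurable_const_smul _)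
  have hΦ : ∀ j, Measurable (Φ j) := fun j =>
    ((hHj j).comp ((measurable_pi_apply 0).comp measurable_unimod)).mul
      (measurable_borderWeight hψ'.measurable)
  have h1 : ∀ᵐ B ∂(coneMeasure (k + 2)),
      ψ B * ∑' q : {q : Fin (k + 2) → ℤ // q ≠ 0}, H (latVec q.1 (unimod B)) =
        ∑' j, ψ B * ∑' γ, Φ j (toR γ * B) := by
    filter_upwards [ae_coneMeasure, ae_latVec_row_ne_zero (k + 1)] with B hB hB'
    rw [ENNReal.tsum_mul_left, tsum_ne_zero_eq (fun q => H (latVec q (unimod B)))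
      (fun γ => borderWeight ψ' (toR γ * B))
      fun γ₀ => tsum_fiber_borderWeight hψ' hB.1 γ₀ (hB' γ₀)]
    simp only [Φ, unimod_mul (det_toR _), toR_mul_zero, latVec_nsmul]
  rw [lintegral_congr_ae h1, lintegral_tsum fun j => ?_]
  · simp_rw [hψ.lintegral_mul_tsum (hΦ _), Φ]
    have h2 : ∀ j : ℕ, ∫⁻ B, H (((j : ℝ) + 1) • unimod B 0) * borderWeight ψ' B
        ∂(coneMeasure (k + 2)) = ENNReal.ofReal (((j : ℝ) + 1) ^ (k + 2))⁻¹ *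
          ((∫⁻ B, ENNReal.ofReal B.det * ψ' B ∂(coneMeasure (k + 1))) * ∫⁻ u, H u) := by
      intro j
      rw [lintegral_row_mul_borderWeight hψ'.measurable (hHj j),
        lintegral_comp_smul_pi hH (by positivity)]
      ring
    simp_rw [h2]
    rw [ENNReal.tsum_mul_right, mul_assoc]
  · exact (hψ.measurable.mul (Measurable.tsum fun γ =>
      (hΦ j).comp (measurable_toR_mul γ))).aemeasurable

theorem IsOrbitWeight.le_one {n : ℕ} {ψ : Matrix (Fin n) (Fin n) ℝ → ℝ≥0∞}
    (hψ : IsOrbitWeight ψ) {B : Matrix (Fin n) (Fin n) ℝ} (hB : 0 < B.det) : ψ B ≤ 1 := by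
  rw [← hψ.tsum_eq_one B hB]
  refine le_trans ?_ (ENNReal.le_tsum 1)
  rw [toR_one, one_mul]

/-- Integration over the unit cube of a periodised function. -/
theorem setLIntegral_unitCube_tsum {n : ℕ} {G : (Fin n → ℝ) → ℝ≥0∞} (hG : Measurable G) :
    ∫⁻ t in unitCube n, ∑' p : Fin n → ℤ, G ((fun i => (p i : ℝ)) + t) = ∫⁻ t, G t := by
  have hI : Measurable ((unitCube n).indicator (1 : (Fin n → ℝ) → ℝ≥0∞)) :=
    measurable_one.indicator measurableSet_unitCube
  have hGp : ∀ p : Fin n → ℤ, Measurable fun t : Fin n → ℝ => G ((fun i => (p i : ℝ)) + t) :=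
    fun p => hG.comp (measurable_const_add _)
  have hIp : ∀ p : Fin n → ℤ, Measurable fun t : Fin n → ℝ =>
      (unitCube n).indicator (1 : (Fin n → ℝ) → ℝ≥0∞) ((fun i => (p i : ℝ)) + t) :=
    fun p => hI.comp (measurable_const_add _)
  calc _ = ∑' p : Fin n → ℤ, ∫⁻ t in unitCube n, G ((fun i => (p i : ℝ)) + t) :=
        lintegral_tsum fun p => (hGp p).aemeasurable
    _ = ∑' p : Fin n → ℤ, ∫⁻ t, (unitCube n).indicator (1 : (Fin n → ℝ) → ℝ≥0∞)
          ((fun i => ((-p) i : ℝ)) + t) * G t := by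
        refine tsum_congr fun p => ?_
        rw [← lintegral_add_left_eq_self (fun t => (unitCube n).indicator
          (1 : (Fin n → ℝ) → ℝ≥0∞) ((fun i => ((-p) i : ℝ)) + t) * G t) (fun i => (p i : ℝ)),
          ← lintegral_indicator measurableSet_unitCube]
        refine lintegral_congr fun t => ?_
        have : ((fun i => ((-p) i : ℝ)) + ((fun i => (p i : ℝ)) + t)) = t := by
          ext i; simp
        rw [this]
        by_cases ht : t ∈ unitCube n
        · simp [Set.indicator_of_mem ht]
        · simp [Set.indicator_of_notMem ht]
    _ = ∫⁻ t, ∑' p : Fin n → ℤ, (unitCube n).indicator (1 : (Fin n → ℝ) → ℝ≥0∞)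
          ((fun i => ((-p) i : ℝ)) + t) * G t :=
        (lintegral_tsum fun p => ((hIp (-p)).mul hG).aemeasurable).symm
    _ = _ := by
        refine lintegral_congr fun t => ?_
        have h1 := (Equiv.neg (Fin n → ℤ)).tsum_eq (fun p : Fin n → ℤ =>
          (unitCube n).indicator (1 : (Fin n → ℝ) → ℝ≥0∞) ((fun i => (p i : ℝ)) + t))
        simp only [Equiv.neg_apply] at h1
        rw [ENNReal.tsum_mul_right, h1, tsum_unitCube, one_mul]

theorem vecMul_add_latVec {n : ℕ} (p : Fin n → ℤ) (t : Fin n → ℝ) (B : Matrix (Fin n) (Fin n) ℝ) :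
    ((fun i => (p i : ℝ)) + t) ᵥ* B = latVec p B + t ᵥ* B := Matrix.add_vecMul _ _ _

theorem latVec_sub {n : ℕ} (p q : Fin n → ℤ) (B : Matrix (Fin n) (Fin n) ℝ) :
    latVec (p - q) B = latVec p B - latVec q B := by
  rw [latVec, latVec, latVec, ← Matrix.sub_vecMul]
  congr 1
  ext i; simp

/-- Minkowski's theorem: by volume, two distinct translates of the unit ball by vectors of a
unimodular lattice meet. -/
theorem exists_latVec_mem_ball {n : ℕ} (hn : n ≠ 0) {B : Matrix (Fin n) (Fin n) ℝ}
    (hB : B.det = 1) : ∃ q : Fin n → ℤ, q ≠ 0 ∧ latVec q B ∈ Metric.ball (0 : Fin n → ℝ) 2 := by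
  by_contra! hno
  let G : (Fin n → ℝ) → ℝ≥0∞ := fun t => (Metric.ball (0 : Fin n → ℝ) 1).indicator 1 (t ᵥ* B)
  have hb : Measurable ((Metric.ball (0 : Fin n → ℝ) 1).indicator (1 : (Fin n → ℝ) → ℝ≥0∞)) :=
    measurable_one.indicator measurableSet_ball
  have hG : Measurable G := hb.comp (measurePreserving_vecMul hB).measurable
  have h1 : ∫⁻ t, G t = 2 ^ n := by
    refine ((measurePreserving_vecMul hB).lintegral_comp hb).trans ?_
    rw [lintegral_indicator_one measurableSet_ball, Real.volume_pi_ball _ one_pos]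
    simp
  have h2 : ∀ t : Fin n → ℝ, ∑' p : Fin n → ℤ, G ((fun i => (p i : ℝ)) + t) ≤ 1 := by
    intro t
    by_cases h : ∃ p₀ : Fin n → ℤ, ((fun i => (p₀ i : ℝ)) + t) ᵥ* B ∈ Metric.ball 0 1
    · obtain ⟨p₀, hp₀⟩ := h
      rw [tsum_eq_single p₀]
      · exact Set.indicator_le_self' (fun _ _ => zero_le) _
      · intro p hp
        refine Set.indicator_of_notMem (fun hp' => hno (p - p₀) (sub_ne_zero.2 hp) ?_) _
        rw [vecMul_add_latVec, mem_ball_zero_iff] at hp₀ hp'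
        rw [mem_ball_zero_iff, latVec_sub]
        calc ‖latVec p B - latVec p₀ B‖
            = ‖(latVec p B + t ᵥ* B) - (latVec p₀ B + t ᵥ* B)‖ := by rw [add_sub_add_right_eq_sub]
          _ ≤ _ := norm_sub_le _ _
          _ < 2 := by linarith
    · push Not at h
      have : ∀ p : Fin n → ℤ, G ((fun i => (p i : ℝ)) + t) = 0 := fun p =>
        Set.indicator_of_notMem (h p) _
      simp [this]
  have h3 := setLIntegral_unitCube_tsum hG
  rw [h1] at h3
  have h4 : (2 : ℝ≥0∞) ^ n ≤ 1 := by
    rw [← h3]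
    refine (lintegral_mono h2).trans ?_
    rw [lintegral_const, Measure.restrict_apply_univ, volume_unitCube, one_mul]
  exact absurd h4 (not_le.2 (one_lt_pow₀ ENNReal.one_lt_two hn))

theorem tsum_inv_pow_ne_top (k : ℕ) :
    ∑' j : ℕ, ENNReal.ofReal (((j : ℝ) + 1) ^ (k + 2))⁻¹ ≠ ∞ := by
  have h := (summable_nat_add_iff 1).2 (Real.summable_nat_pow_inv.2 (show 1 < k + 2 by omega))
  have := h.tsum_ofReal_ne_top
  simpa using this

/-- `SL_n(ℤ)` has finite covolume: Siegel's formula for the indicator of a ball reduces the claim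
to dimension `n - 1`. -/
theorem IsOrbitWeight.lintegral_ne_top : ∀ {m : ℕ}
    {ψ : Matrix (Fin (m + 1)) (Fin (m + 1)) ℝ → ℝ≥0∞}, IsOrbitWeight ψ →
      ∫⁻ B, ψ B ∂(coneMeasure (m + 1)) ≠ ∞
  | 0, ψ, hψ => by
    have h1 : ∫⁻ B, ψ B ∂(coneMeasure 1) ≤ ∫⁻ _, 1 ∂(coneMeasure 1) := by
      refine lintegral_mono_ae ?_
      filter_upwards [ae_coneMeasure] with B hB using hψ.le_one hB.1
    refine ne_top_of_le_ne_top ?_ h1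
    rw [lintegral_one, coneMeasure, Measure.restrict_apply_univ]
    have h2 : detCone 1 ⊆ (Set.Icc 0 1 : Set (Fin 1 → Fin 1 → ℝ)) := by
      intro B hB
      have hB' : 0 < B 0 0 ∧ B 0 0 ≤ 1 := by
        have := hB
        simp only [detCone, Set.mem_ofPred_eq, Matrix.det_fin_one] at this
        exact this
      refine ⟨fun i j => ?_, fun i j => ?_⟩
      · rw [Subsingleton.elim i 0, Subsingleton.elim j 0]; exact hB'.1.le
      · rw [Subsingleton.elim i 0, Subsingleton.elim j 0]; exact hB'.2
    have h3 : (volume : Measure (Fin 1 → Fin 1 → ℝ)) (Set.Icc 0 1) ≠ ∞ :=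
      isCompact_Icc.measure_lt_top.ne
    exact ne_top_of_le_ne_top h3 (measure_mono h2)
  | m + 1, ψ, hψ => by
    obtain ⟨ψ', hψ'⟩ := exists_isOrbitWeight (m + 1)
    have hV := hψ'.lintegral_ne_top
    let H : (Fin (m + 2) → ℝ) → ℝ≥0∞ := (Metric.ball 0 2).indicator 1
    have hH : Measurable H := measurable_one.indicator measurableSet_ball
    have h1 := lintegral_mul_tsum_latVec hψ hψ' hH
    have h2 : ∫⁻ B, ψ B ∂(coneMeasure (m + 2)) ≤
        ∫⁻ B, ψ B * ∑' q : {q : Fin (m + 2) → ℤ // q ≠ 0}, H (latVec q.1 (unimod B))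
          ∂(coneMeasure (m + 2)) := by
      refine lintegral_mono_ae ?_
      filter_upwards [ae_coneMeasure] with B hB
      obtain ⟨q, hq, hqB⟩ := exists_latVec_mem_ball (by omega) (det_unimod (by omega) hB.1)
      calc ψ B = ψ B * H (latVec q (unimod B)) := by
            rw [show H (latVec q (unimod B)) = 1 from Set.indicator_of_mem hqB _, mul_one]
        _ ≤ _ := by
          gcongr
          exact ENNReal.le_tsum (f := fun q : {q : Fin (m + 2) → ℤ // q ≠ 0} =>
            H (latVec q.1 (unimod B))) ⟨q, hq⟩
    refine ne_top_of_le_ne_top ?_ (h2.trans h1.le)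
    refine ENNReal.mul_ne_top (ENNReal.mul_ne_top (tsum_inv_pow_ne_top m) ?_) ?_
    · refine ne_top_of_le_ne_top hV (lintegral_mono_ae ?_)
      filter_upwards [ae_coneMeasure] with B hB
      calc ENNReal.ofReal B.det * ψ' B ≤ 1 * ψ' B := by
            gcongr; exact ENNReal.ofReal_le_one.2 hB.2
        _ = ψ' B := one_mul _
    · rw [lintegral_indicator_one measurableSet_ball]
      exact measure_ball_lt_top.ne

/-! ### Siegel's mean value theorem -/

open Filter Topology

/-- The number of vectors of the lattice spanned by the rows of `B` in the sup norm ball of radius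
`r` around the origin. -/
noncomputable def ballCount {n : ℕ} (r : ℝ) (B : Matrix (Fin n) (Fin n) ℝ) : ℝ≥0∞ :=
  ∑' q : Fin n → ℤ, (Metric.ball (0 : Fin n → ℝ) r).indicator 1 (latVec q B)

theorem latVec_add {n : ℕ} (p q : Fin n → ℤ) (B : Matrix (Fin n) (Fin n) ℝ) :
    latVec (p + q) B = latVec p B + latVec q B := by
  rw [latVec, latVec, latVec, ← Matrix.add_vecMul]
  congr 1
  ext i; simp

/-- The cube of side `2r` splits into `(2r)^n` unit cubes, and differences of lattice vectors in a
common unit cube lie in the unit ball. -/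
theorem ballCount_le {n : ℕ} (r : ℕ) (B : Matrix (Fin n) (Fin n) ℝ) :
    ballCount r B ≤ ((2 * r : ℕ) : ℝ≥0∞) ^ n * ballCount 1 B := by
  classical
  let S : Finset (Fin n → ℤ) := Fintype.piFinset fun _ => Finset.Ico (-(r : ℤ)) r
  let c : (Fin n → ℤ) → (Fin n → ℤ) → ℝ≥0∞ := fun κ q =>
    if (fun i => ⌊latVec q B i⌋) = κ then 1 else 0
  have h1 : ∀ q : Fin n → ℤ, (Metric.ball (0 : Fin n → ℝ) r).indicator 1 (latVec q B) ≤
      ∑ κ ∈ S, c κ q := by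
    intro q
    by_cases hq : latVec q B ∈ Metric.ball (0 : Fin n → ℝ) r
    · rw [Set.indicator_of_mem hq]
      have hmem : (fun i => ⌊latVec q B i⌋) ∈ S := by
        simp only [S, Fintype.mem_piFinset, Finset.mem_Ico]
        intro i
        have h2 : |latVec q B i| < r :=
          (norm_le_pi_norm (latVec q B) i).trans_lt (mem_ball_zero_iff.1 hq)
        rw [abs_lt] at h2
        exact ⟨Int.le_floor.2 (by push_cast; exact h2.1.le),
          Int.floor_lt.2 (by exact_mod_cast h2.2)⟩
      refine le_trans ?_ (Finset.single_le_sum (f := fun κ => c κ q) (fun _ _ => zero_le) hmem)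
      simp [c]
    · rw [Set.indicator_of_notMem hq]; exact zero_le
  have h2 : ∀ κ, ∑' q, c κ q ≤ ballCount 1 B := by
    intro κ
    by_cases h : ∃ q₀ : Fin n → ℤ, (fun i => ⌊latVec q₀ B i⌋) = κ
    · obtain ⟨q₀, h₀⟩ := h
      rw [← (Equiv.addRight q₀).tsum_eq]
      refine ENNReal.tsum_le_tsum fun q => ?_
      by_cases hq : (fun i => ⌊latVec (q + q₀) B i⌋) = κ
      · have hmem : latVec q B ∈ Metric.ball (0 : Fin n → ℝ) 1 := by
          rw [mem_ball_zero_iff, pi_norm_lt_iff one_pos]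
          intro i
          have h3 : ⌊latVec (q + q₀) B i⌋ = ⌊latVec q₀ B i⌋ :=
            (congrFun hq i).trans (congrFun h₀ i).symm
          have h4 := Int.abs_sub_lt_one_of_floor_eq_floor h3
          rwa [latVec_add, Pi.add_apply, add_sub_cancel_right] at h4
        rw [Set.indicator_of_mem hmem]
        simp only [c, Equiv.coe_addRight, if_pos hq, Pi.one_apply, le_refl]
      · simp only [c, Equiv.coe_addRight, if_neg hq, zero_le]
    · push Not at h
      simp [c, h]
  calc ballCount r B ≤ ∑' q, ∑ κ ∈ S, c κ q := ENNReal.tsum_le_tsum h1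
    _ = ∑ κ ∈ S, ∑' q, c κ q := Summable.tsum_finsetSum fun _ _ => ENNReal.summable
    _ ≤ ∑ κ ∈ S, ballCount 1 B := Finset.sum_le_sum fun κ _ => h2 κ
    _ = _ := by
      rw [Finset.sum_const, nsmul_eq_mul]
      congr 1
      simp only [S, Fintype.card_piFinset, Int.card_Ico, Finset.prod_const, Finset.card_univ,
        Fintype.card_fin]
      rw [show ((r : ℤ) - -r).toNat = 2 * r by omega]
      push_cast
      rfl

open scoped Pointwise in
/-- Asymptotics of the number of lattice vectors in large balls. -/
theorem tendsto_ballCount {n : ℕ} {B : Matrix (Fin n) (Fin n) ℝ} (hB : B.det = 1) :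
    Tendsto (fun r : ℕ => ballCount r B / (r : ℝ≥0∞) ^ n) atTop (𝓝 (2 ^ n)) := by
  let s : Set (Fin n → ℝ) := (fun t => t ᵥ* B) ⁻¹' Metric.ball 0 1
  have hmp := measurePreserving_vecMul hB
  have hs : MeasurableSet s := hmp.measurable measurableSet_ball
  have hvol : volume s = 2 ^ n := by
    rw [hmp.measure_preimage measurableSet_ball.nullMeasurableSet, Real.volume_pi_ball _ one_pos]
    simp
  have hinv : ∀ t : Fin n → ℝ, (t ᵥ* B) ᵥ* B⁻¹ = t := fun t => by
    rw [Matrix.vecMul_vecMul, Matrix.mul_nonsing_inv _ (by simp [hB]), Matrix.vecMul_one]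
  have hbdd : Bornology.IsBounded s := by
    have hc : Continuous fun v : Fin n → ℝ => v ᵥ* B⁻¹ := by fun_prop
    refine ((isCompact_closedBall (0 : Fin n → ℝ) 1).image hc).isBounded.subset fun t ht => ?_
    exact ⟨t ᵥ* B, Metric.ball_subset_closedBall ht, hinv t⟩
  have hconv : Convex ℝ s := by
    have : s = (Matrix.vecMulLinear B) ⁻¹' Metric.ball 0 1 := rfl
    rw [this]
    exact (convex_ball _ _).linear_preimage _
  have hlim := tendsto_card_div_pow_atTop_volume s hbdd hs (hconv.addHaar_frontier volume)
  have hlim2 := ENNReal.tendsto_ofReal hlim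
  rw [measureReal_def, hvol, ENNReal.ofReal_toReal (by finiteness), Fintype.card_fin] at hlim2
  refine hlim2.congr' ?_
  filter_upwards [eventually_gt_atTop 0] with r hr
  have hr' : (0 : ℝ) < r := Nat.cast_pos.2 hr
  have : NeZero r := ⟨hr.ne'⟩
  let A : Set (Fin n → ℤ) := {q | latVec q B ∈ Metric.ball (0 : Fin n → ℝ) r}
  let e : (Fin n → ℤ) → (Fin n → ℝ) := fun q => (r : ℝ)⁻¹ • fun i => (q i : ℝ)
  have he : Function.Injective e := by
    intro p q h
    ext i
    have := congrFun h i
    simp only [e, Pi.smul_apply, smul_eq_mul] at this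
    exact_mod_cast mul_left_cancel₀ (inv_ne_zero hr'.ne') this
  have hes : ∀ q, e q ∈ s ↔ q ∈ A := by
    intro q
    change ((r : ℝ)⁻¹ • fun i => (q i : ℝ)) ᵥ* B ∈ Metric.ball (0 : Fin n → ℝ) 1 ↔
      latVec q B ∈ Metric.ball (0 : Fin n → ℝ) r
    rw [Matrix.smul_vecMul, mem_ball_zero_iff, mem_ball_zero_iff, norm_smul, norm_inv,
      Real.norm_of_nonneg hr'.le, inv_mul_lt_iff₀ hr', mul_one]
    rfl
  have himg : s ∩ ((r : ℝ)⁻¹ • (Submodule.span ℤ (Set.range (Pi.basisFun ℝ (Fin n))) :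
      Set (Fin n → ℝ))) = e '' A := by
    ext t
    constructor
    · rintro ⟨ht, ht'⟩
      have h1 := BoxIntegral.unitPartition.mem_smul_span_iff.1 ht'
      choose q hq using h1
      have h2 : e q = t := by
        ext i
        have := hq i
        simp only [algebraMap_int_eq, eq_intCast] at this
        simp only [e, Pi.smul_apply, smul_eq_mul, this]
        field_simp
      exact ⟨q, (hes q).1 (h2 ▸ ht), h2⟩
    · rintro ⟨q, hq, rfl⟩
      refine ⟨(hes q).2 hq, BoxIntegral.unitPartition.mem_smul_span_iff.2 fun i => ⟨q i, ?_⟩⟩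
      simp only [algebraMap_int_eq, eq_intCast, e, Pi.smul_apply, smul_eq_mul]
      field_simp
  have hAfin : A.Finite := by
    obtain ⟨R, hR⟩ := hbdd.exists_norm_le
    refine (Set.finite_Icc (fun _ => -⌈r * R⌉) (fun _ : Fin n => ⌈r * R⌉)).subset fun q hq => ?_
    have h1 : ∀ i, |(q i : ℝ)| ≤ r * R := by
      intro i
      have h2 := (norm_le_pi_norm (e q) i).trans (hR _ ((hes q).2 hq))
      simp only [e, Pi.smul_apply, smul_eq_mul, norm_mul, norm_inv, Real.norm_eq_abs,
        Nat.abs_cast] at h2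
      rwa [inv_mul_le_iff₀ hr'] at h2
    refine ⟨fun i => ?_, fun i => ?_⟩
    · have h4 := Int.le_ceil (r * R)
      exact_mod_cast (neg_le_neg h4).trans (abs_le.1 (h1 i)).1
    · exact_mod_cast (abs_le.1 (h1 i)).2.trans (Int.le_ceil (r * R))
  have hcount : ballCount r B = (Nat.card A : ℝ≥0∞) := by
    have h1 : ∀ q, (Metric.ball (0 : Fin n → ℝ) r).indicator (1 : (Fin n → ℝ) → ℝ≥0∞)
        (latVec q B) = A.indicator 1 q := fun q => rfl
    have h2 : ∀ q ∈ hAfin.toFinset, A.indicator (1 : (Fin n → ℤ) → ℝ≥0∞) q = 1 := fun q hq =>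
      Set.indicator_of_mem (by simpa using hq) _
    rw [ballCount, tsum_congr h1, tsum_eq_sum (s := hAfin.toFinset) fun q hq =>
      Set.indicator_of_notMem (by simpa using hq) _, Nat.card_coe_set_eq,
      Set.ncard_eq_toFinset_card A hAfin, Finset.sum_congr rfl h2]
    simp
  rw [himg, Nat.card_image_of_injective he, hcount, ENNReal.ofReal_div_of_pos (by positivity),
    ENNReal.ofReal_natCast, ENNReal.ofReal_pow hr'.le, ENNReal.ofReal_natCast]

theorem ballCount_eq {n : ℕ} {r : ℝ} (hr : 0 < r) (B : Matrix (Fin n) (Fin n) ℝ) :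
    ballCount r B = 1 + ∑' q : {q : Fin n → ℤ // q ≠ 0},
      (Metric.ball (0 : Fin n → ℝ) r).indicator 1 (latVec q.1 B) := by
  let f : (Fin n → ℤ) → ℝ≥0∞ := fun q => (Metric.ball (0 : Fin n → ℝ) r).indicator 1 (latVec q B)
  have h : ∑' q : ({0} : Set (Fin n → ℤ)), f q + ∑' q : (({0} : Set (Fin n → ℤ))ᶜ : Set _), f q =
      ∑' q, f q := ENNReal.summable.tsum_add_tsum_compl ENNReal.summable
  have h0 : f 0 = 1 := by
    have : latVec (0 : Fin n → ℤ) B = 0 := by simp [latVec, ← Pi.zero_def]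
    simp [f, this, hr]
  rw [tsum_singleton, h0] at h
  exact h.symm

/-- **Siegel's mean value theorem** on the cone over `SL_n(ℝ)`. The constant is found by testing on
balls of radius `r → ∞`, where lattice point counts are asymptotic to volumes and are dominated by
`ballCount_le`. -/
theorem siegel_mean_value {k : ℕ} {ψ : Matrix (Fin (k + 2)) (Fin (k + 2)) ℝ → ℝ≥0∞}
    (hψ : IsOrbitWeight ψ) {H : (Fin (k + 2) → ℝ) → ℝ≥0∞} (hH : Measurable H) :
    ∫⁻ B, ψ B * ∑' q : {q : Fin (k + 2) → ℤ // q ≠ 0}, H (latVec q.1 (unimod B))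
      ∂(coneMeasure (k + 2)) = (∫⁻ B, ψ B ∂(coneMeasure (k + 2))) * ∫⁻ u, H u := by
  obtain ⟨C, hCtop, hsieg⟩ : ∃ C : ℝ≥0∞, C ≠ ∞ ∧ ∀ {H : (Fin (k + 2) → ℝ) → ℝ≥0∞}, Measurable H →
      ∫⁻ B, ψ B * ∑' q : {q : Fin (k + 2) → ℤ // q ≠ 0}, H (latVec q.1 (unimod B))
        ∂(coneMeasure (k + 2)) = C * ∫⁻ u, H u := by
    obtain ⟨ψ', hψ'⟩ := exists_isOrbitWeight (k + 1)
    refine ⟨_, ENNReal.mul_ne_top (tsum_inv_pow_ne_top k) ?_,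
      fun hH => lintegral_mul_tsum_latVec hψ hψ' hH⟩
    refine ne_top_of_le_ne_top hψ'.lintegral_ne_top (lintegral_mono_ae ?_)
    filter_upwards [ae_coneMeasure] with B hB
    calc ENNReal.ofReal B.det * ψ' B ≤ 1 * ψ' B := by
          gcongr; exact ENNReal.ofReal_le_one.2 hB.2
      _ = ψ' B := one_mul _
  let b : ℝ → (Fin (k + 2) → ℝ) → ℝ≥0∞ := fun r => (Metric.ball 0 r).indicator 1
  have hb : ∀ r, Measurable (b r) := fun r => measurable_one.indicator measurableSet_ball
  let M : ℝ → Matrix (Fin (k + 2)) (Fin (k + 2)) ℝ → ℝ≥0∞ := fun r B =>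
    ∑' q : {q : Fin (k + 2) → ℤ // q ≠ 0}, b r (latVec q.1 (unimod B))
  have hM : ∀ r, Measurable (M r) := fun r => Measurable.tsum fun q =>
    (hb r).comp ((measurable_latVec q.1).comp measurable_unimod)
  have hint : ∀ r : ℕ, 0 < r →
      ∫⁻ B, ψ B * (M r B / (r : ℝ≥0∞) ^ (k + 2)) ∂(coneMeasure (k + 2)) = C * 2 ^ (k + 2) := by
    intro r hr
    have hr0 : (r : ℝ≥0∞) ^ (k + 2) ≠ 0 := pow_ne_zero _ (by exact_mod_cast hr.ne')
    have hrt : (r : ℝ≥0∞) ^ (k + 2) ≠ ∞ := by finiteness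
    simp_rw [div_eq_mul_inv, ← mul_assoc]
    rw [lintegral_mul_const (f := fun B => ψ B * M r B) _ (hψ.measurable.mul (hM r)), hsieg (hb r),
      lintegral_indicator_one measurableSet_ball, Real.volume_pi_ball _ (Nat.cast_pos.2 hr),
      Fintype.card_fin, ENNReal.ofReal_pow (by positivity), ENNReal.ofReal_mul zero_le_two,
      ENNReal.ofReal_natCast, mul_pow, mul_assoc, mul_assoc, ENNReal.mul_inv_cancel hr0 hrt]
    simp
  have hlim : Tendsto (fun r : ℕ => ∫⁻ B, ψ B * (M r B / (r : ℝ≥0∞) ^ (k + 2))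
      ∂(coneMeasure (k + 2))) atTop (𝓝 (∫⁻ B, ψ B * 2 ^ (k + 2) ∂(coneMeasure (k + 2)))) := by
    refine tendsto_lintegral_filter_of_dominated_convergence
      (fun B => ψ B * (2 ^ (k + 2) * (1 + M 1 B))) ?_ ?_ ?_ ?_
    · exact Eventually.of_forall fun r => hψ.measurable.mul ((hM r).div_const _)
    · filter_upwards [eventually_gt_atTop 0] with r hr
      refine Eventually.of_forall fun B => ?_
      have hr0 : (r : ℝ≥0∞) ^ (k + 2) ≠ 0 := pow_ne_zero _ (by exact_mod_cast hr.ne')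
      gcongr
      refine ENNReal.div_le_of_le_mul ?_
      have h1 : M r B ≤ ballCount r (unimod B) := by
        rw [ballCount_eq (Nat.cast_pos.2 hr)]; exact le_add_self
      refine h1.trans ((ballCount_le r _).trans_eq ?_)
      rw [ballCount_eq one_pos]
      push_cast
      rw [mul_pow]
      change 2 ^ (k + 2) * (r : ℝ≥0∞) ^ (k + 2) * (1 + M 1 B) = _
      ring
    · have h1 : ∀ B, ψ B * (2 ^ (k + 2) * (1 + M 1 B)) =
          2 ^ (k + 2) * (ψ B + ψ B * M 1 B) := fun B => by ring
      simp_rw [h1]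
      rw [lintegral_const_mul (f := fun B => ψ B + ψ B * M 1 B) _
          (hψ.measurable.add (hψ.measurable.mul (hM 1))),
        lintegral_add_left hψ.measurable, hsieg (hb 1), lintegral_indicator_one measurableSet_ball]
      have := hψ.lintegral_ne_top
      have hball : volume (Metric.ball (0 : Fin (k + 2) → ℝ) 1) ≠ ∞ := measure_ball_lt_top.ne
      finiteness
    · filter_upwards [ae_coneMeasure] with B hB
      have hψ1 : ψ B ≠ ∞ := ne_top_of_le_ne_top ENNReal.one_ne_top (hψ.le_one hB.1)
      refine ENNReal.Tendsto.const_mul ?_ (Or.inr hψ1)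
      have h1 := tendsto_ballCount (det_unimod (by omega) hB.1)
      have h2 : Tendsto (fun r : ℕ => (1 : ℝ≥0∞) / (r : ℝ≥0∞) ^ (k + 2)) atTop (𝓝 0) := by
        simp_rw [one_div, ENNReal.inv_pow]
        have := ENNReal.Tendsto.pow (n := k + 2) ENNReal.tendsto_inv_nat_nhds_zero
        rwa [zero_pow (by omega)] at this
      have h3 := ENNReal.Tendsto.sub h1 h2 (Or.inl (by finiteness))
      rw [tsub_zero] at h3
      refine h3.congr' ?_
      filter_upwards [eventually_gt_atTop 0] with r hr
      have hr0 : (r : ℝ≥0∞) ^ (k + 2) ≠ 0 := pow_ne_zero _ (by exact_mod_cast hr.ne')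
      rw [ballCount_eq (Nat.cast_pos.2 hr), ENNReal.add_div, ENNReal.add_sub_cancel_left
        (ENNReal.div_ne_top ENNReal.one_ne_top hr0)]
  have hlim2 : Tendsto (fun r : ℕ => ∫⁻ B, ψ B * (M r B / (r : ℝ≥0∞) ^ (k + 2))
      ∂(coneMeasure (k + 2))) atTop (𝓝 (C * 2 ^ (k + 2))) := by
    refine tendsto_const_nhds.congr' ?_
    filter_upwards [eventually_gt_atTop 0] with r hr using (hint r hr).symm
  have heq := tendsto_nhds_unique hlim2 hlim
  rw [lintegral_mul_const _ hψ.measurable] at heq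
  have hCV : C = ∫⁻ B, ψ B ∂(coneMeasure (k + 2)) :=
    (ENNReal.mul_left_inj (by positivity) (by finiteness)).1 heq
  rw [hsieg hH, hCV]

end SiegelMean

/-! ### The group of affine transformations -/

open Topology

namespace AffSL

variable {d : ℕ}

theorem isClosedEmbedding_matrix_prod :
    IsClosedEmbedding fun g : AffSL d => ((g.lin : Matrix (Fin d) (Fin d) ℝ), g.trans) := by
  have h1 : IsClosedEmbedding fun g : AffSL d => (g.lin, g.trans) :=
    { eq_induced := rfl
      injective := fun g h e => AffSL.ext (congrArg Prod.fst e) (congrArg Prod.snd e)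
      isClosed_range := by
        rw [Set.range_eq_univ.2 fun p => ⟨⟨p.1, p.2⟩, rfl⟩]
        exact isClosed_univ }
  exact (Matrix.SpecialLinearGroup.isClosedEmbedding_val.prodMap IsClosedEmbedding.id).comp h1

instance : PolishSpace (AffSL d) := isClosedEmbedding_matrix_prod.polishSpace

theorem continuous_coe_lin :
    Continuous fun g : AffSL d => (g.lin : Matrix (Fin d) (Fin d) ℝ) :=
  continuous_fst.comp isClosedEmbedding_matrix_prod.continuous

theorem continuous_trans : Continuous fun g : AffSL d => g.trans :=
  continuous_snd.comp isClosedEmbedding_matrix_prod.continuous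

theorem continuous_coe_lin_inv :
    Continuous fun g : AffSL d =>
      ((g.lin⁻¹ : Matrix.SpecialLinearGroup (Fin d) ℝ) : Matrix (Fin d) (Fin d) ℝ) := by
  simp_rw [Matrix.SpecialLinearGroup.coe_inv]
  exact continuous_coe_lin.matrix_adjugate

instance : IsTopologicalGroup (AffSL d) where
  continuous_mul := by
    refine isClosedEmbedding_matrix_prod.continuous_iff.2 ?_
    have h1 := (continuous_coe_lin (d := d)).comp (continuous_fst (X := AffSL d) (Y := AffSL d))
    have h2 := (continuous_coe_lin (d := d)).comp (continuous_snd (X := AffSL d) (Y := AffSL d))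
    have h3 := (continuous_trans (d := d)).comp (continuous_fst (X := AffSL d) (Y := AffSL d))
    have h4 := (continuous_trans (d := d)).comp (continuous_snd (X := AffSL d) (Y := AffSL d))
    exact (h1.matrix_mul h2).prodMk ((h1.matrix_mulVec h4).add h3)
  continuous_inv := by
    refine isClosedEmbedding_matrix_prod.continuous_iff.2 ?_
    exact continuous_coe_lin_inv.prodMk (continuous_coe_lin_inv.matrix_mulVec continuous_trans).neg

instance : MeasurableSpace (AffSL d) := borel _

instance : BorelSpace (AffSL d) := ⟨rfl⟩

theorem measurable_toFun (w : Fin d → ℝ) : Measurable fun g : AffSL d => g.toFun w :=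
  ((continuous_coe_lin.matrix_mulVec continuous_const).add continuous_trans).measurable

end AffSL

namespace SiegelMean

open AffineUnimodularLattice

variable {d : ℕ}

/-! ### The space of affine lattices -/

/-- The parametrisation `(γ, p) ↦ (γᵀ, γᵀ p)` of the stabiliser `SL_d(ℤ) ⋉ ℤ^d` of `ℤ^d`. The
transposes translate between lattices spanned by rows and the action on column vectors. -/
noncomputable def intAff (x : Matrix.SpecialLinearGroup (Fin d) ℤ × (Fin d → ℤ)) : AffSL d :=
  ⟨⟨(toR x.1)ᵀ, by rw [Matrix.det_transpose, det_toR]⟩, latVec x.2 (toR x.1)⟩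

theorem latVec_toR (γ : Matrix.SpecialLinearGroup (Fin d) ℤ) (p : Fin d → ℤ) :
    latVec p (toR γ) = fun i => ((p ᵥ* γ.1) i : ℝ) := by
  ext i
  simp [latVec, toR, Matrix.vecMul, dotProduct]

theorem toFun_intAff (x : Matrix.SpecialLinearGroup (Fin d) ℤ × (Fin d → ℤ)) (q : Fin d → ℤ) :
    (intAff x).toFun (fun i => (q i : ℝ)) = fun i => (((q + x.2) ᵥ* x.1.1) i : ℝ) := by
  rw [← latVec_toR, latVec_add, AffSL.toFun]
  change (toR x.1)ᵀ *ᵥ _ + latVec x.2 (toR x.1) = _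
  rw [Matrix.mulVec_transpose]
  rfl

theorem intAff_injective : Function.Injective (intAff (d := d)) := by
  rintro ⟨γ, p⟩ ⟨δ, q⟩ h
  have h1 : (toR γ)ᵀ = (toR δ)ᵀ := congrArg (fun g : AffSL d => g.lin.1) h
  have h2 : γ = δ := by
    ext i j
    have := congrFun (congrFun h1 j) i
    simp only [Matrix.transpose_apply, toR_apply] at this
    exact_mod_cast this
  subst h2
  have h3 : latVec p (toR γ) = latVec q (toR γ) := congrArg AffSL.trans h
  have h4 : p ᵥ* γ.1 = q ᵥ* γ.1 := by
    rw [latVec_toR, latVec_toR] at h3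
    ext i
    exact_mod_cast congrFun h3 i
  have h5 := congrArg (fun v => v ᵥ* (γ⁻¹).1) h4
  have h6 : γ.1 * (γ⁻¹).1 = 1 := congrArg Subtype.val (mul_inv_cancel γ)
  simp only [Matrix.vecMul_vecMul, h6, Matrix.vecMul_one] at h5
  rw [h5]

theorem coe_smul_std (g : AffSL d) : (g • std d).1 = g.toFun '' stdLattice d := rfl

theorem intAff_smul_std (x : Matrix.SpecialLinearGroup (Fin d) ℤ × (Fin d → ℤ)) :
    intAff x • std d = std d := by
  refine Subtype.ext ?_
  rw [coe_smul_std]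
  change _ = stdLattice d
  ext z
  constructor
  · rintro ⟨_, ⟨q, rfl⟩, rfl⟩
    exact ⟨_, (toFun_intAff x q).symm⟩
  · rintro ⟨q, rfl⟩
    refine ⟨_, ⟨q ᵥ* (x.1⁻¹).1 - x.2, rfl⟩, ?_⟩
    have h6 : (x.1⁻¹).1 * x.1.1 = 1 := congrArg Subtype.val (inv_mul_cancel x.1)
    refine (toFun_intAff x (q ᵥ* (x.1⁻¹).1 - x.2)).trans ?_
    rw [sub_add_cancel, Matrix.vecMul_vecMul, h6, Matrix.vecMul_one]

theorem exists_intAff_of_forall_int {g : AffSL d} (h1 : ∀ i j, ∃ m : ℤ, (m : ℝ) = g.lin.1 i j)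
    (h2 : ∀ i, ∃ m : ℤ, (m : ℝ) = g.trans i) : ∃ x, intAff x = g := by
  choose N hN using h1
  choose v hv using h2
  have hcast : (Matrix.of N).map (Int.cast : ℤ → ℝ) = g.lin.1 := by ext i j; exact hN i j
  have hdet : (Matrix.of N)ᵀ.det = 1 := by
    have : (((Matrix.of N).det : ℤ) : ℝ) = _ := (Int.castRingHom ℝ).map_det (Matrix.of N)
    rw [RingHom.mapMatrix_apply, Int.coe_castRingHom, hcast, g.lin.2] at this
    rw [Matrix.det_transpose]
    exact_mod_cast this
  let γ : Matrix.SpecialLinearGroup (Fin d) ℤ := ⟨(Matrix.of N)ᵀ, hdet⟩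
  refine ⟨(γ, v ᵥ* (γ⁻¹).1), AffSL.ext (Subtype.ext ?_) ?_⟩
  · ext i j; exact hN i j
  · change latVec (v ᵥ* (γ⁻¹).1) (toR γ) = g.trans
    have h6 : (γ⁻¹).1 * γ.1 = 1 := congrArg Subtype.val (inv_mul_cancel γ)
    rw [latVec_toR, Matrix.vecMul_vecMul, h6, Matrix.vecMul_one]
    exact funext hv

theorem exists_int_of_smul_std {g : AffSL d} (hg : g • std d = std d) :
    (∀ i j, ∃ m : ℤ, (m : ℝ) = g.lin.1 i j) ∧ ∀ i, ∃ m : ℤ, (m : ℝ) = g.trans i := by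
  have hset : g.toFun '' stdLattice d = stdLattice d := congrArg Subtype.val hg
  have hmem : ∀ p : Fin d → ℤ, ∃ q : Fin d → ℤ,
      (fun i => (q i : ℝ)) = g.toFun fun i => (p i : ℝ) := by
    intro p
    have : g.toFun (fun i => (p i : ℝ)) ∈ stdLattice d := hset ▸ ⟨_, ⟨p, rfl⟩, rfl⟩
    exact this
  have htrans : ∀ i, ∃ m : ℤ, (m : ℝ) = g.trans i := by
    intro i
    obtain ⟨q, hq⟩ := hmem 0
    refine ⟨q i, ?_⟩
    have := congrFun hq i
    simpa [AffSL.toFun, ← Pi.zero_def] using this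
  refine ⟨fun i j => ?_, htrans⟩
  obtain ⟨m, hm⟩ := htrans i
  obtain ⟨q, hq⟩ := hmem (Pi.single j 1)
  refine ⟨q i - m, ?_⟩
  have h1 : (fun i => ((Pi.single j 1 : Fin d → ℤ) i : ℝ)) = Pi.single j 1 := by
    ext i; by_cases h : i = j
    · subst h; simp
    · simp [h]
  have h2 := congrFun hq i
  rw [h1, AffSL.toFun, Matrix.mulVec_single_one] at h2
  push_cast
  rw [hm, h2]
  simp

theorem smul_std_eq_iff {g h : AffSL d} : g • std d = h • std d ↔ ∃ x, h * intAff x = g := by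
  constructor
  · intro e
    have h1 : (h⁻¹ * g) • std d = std d := by rw [mul_smul, e, inv_smul_smul]
    obtain ⟨h2, h3⟩ := exists_int_of_smul_std h1
    obtain ⟨x, hx⟩ := exists_intAff_of_forall_int h2 h3
    exact ⟨x, by rw [hx, mul_inv_cancel_left]⟩
  · rintro ⟨x, rfl⟩
    rw [mul_smul, intAff_smul_std]

theorem surjective_smul_std : Function.Surjective fun g : AffSL d => g • std d := by
  rintro ⟨Λ, g, rfl⟩
  exact ⟨g, rfl⟩

theorem continuous_smul_std : Continuous fun g : AffSL d => g • std d := continuous_coinduced_rng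

theorem isOpenQuotientMap_smul_std : IsOpenQuotientMap fun g : AffSL d => g • std d where
  surjective := surjective_smul_std
  continuous := continuous_smul_std
  isOpenMap U hU := by
    rw [isOpen_coinduced]
    have : (fun g : AffSL d => g • std d) ⁻¹' ((fun g : AffSL d => g • std d) '' U) =
        ⋃ x, (fun g => g * intAff x) ⁻¹' U := by
      ext g
      simp only [Set.mem_preimage, Set.mem_image, Set.mem_iUnion]
      constructor
      · rintro ⟨u, hu, e⟩
        obtain ⟨x, hx⟩ := smul_std_eq_iff.1 e
        exact ⟨x, hx ▸ hu⟩
      · rintro ⟨x, hx⟩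
        exact ⟨_, hx, smul_std_eq_iff.2 ⟨x, rfl⟩⟩
    rw [this]
    exact isOpen_iUnion fun x => hU.preimage (continuous_mul_const _)

instance : SecondCountableTopology (AffineUnimodularLattice d) :=
  isOpenQuotientMap_smul_std.isQuotientMap.secondCountableTopology
    isOpenQuotientMap_smul_std.isOpenMap

theorem isClosed_stabilizer : IsClosed {g : AffSL d | g • std d = std d} := by
  have : {g : AffSL d | g • std d = std d} =
      (⋂ i, ⋂ j, (fun g : AffSL d => g.lin.1 i j) ⁻¹' Set.range ((↑) : ℤ → ℝ)) ∩
        ⋂ i, (fun g : AffSL d => g.trans i) ⁻¹' Set.range ((↑) : ℤ → ℝ) := by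
    ext g
    simp only [Set.mem_ofPred_eq, Set.mem_inter_iff, Set.mem_iInter, Set.mem_preimage,
      Set.mem_range]
    constructor
    · exact exists_int_of_smul_std
    · rintro ⟨h1, h2⟩
      obtain ⟨x, rfl⟩ := exists_intAff_of_forall_int h1 h2
      exact intAff_smul_std x
  have hZ : IsClosed (Set.range ((↑) : ℤ → ℝ)) := Int.isClosedEmbedding_coe_real.isClosed_range
  rw [this]
  refine IsClosed.inter (isClosed_iInter fun i => isClosed_iInter fun j => hZ.preimage ?_)
    (isClosed_iInter fun i => hZ.preimage ?_)
  · exact AffSL.continuous_coe_lin.matrix_elem i j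
  · exact (continuous_apply i).comp AffSL.continuous_trans

instance : T1Space (AffineUnimodularLattice d) where
  t1 Λ := by
    obtain ⟨h, rfl⟩ := surjective_smul_std Λ
    rw [← isOpenQuotientMap_smul_std.isQuotientMap.isClosed_preimage]
    have : (fun g : AffSL d => g • std d) ⁻¹' {h • std d} =
        (fun g => h⁻¹ * g) ⁻¹' {g : AffSL d | g • std d = std d} := by
      ext g
      simp only [Set.mem_preimage, Set.mem_singleton_iff, Set.mem_ofPred_eq, mul_smul,
        inv_smul_eq_iff]
    rw [this]
    exact isClosed_stabilizer.preimage (continuous_const_mul _)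

/-- Measurability on the space of lattices is measurability on the group. -/
theorem measurable_of_comp_smul_std {β : Type*} [MeasurableSpace β]
    {F : AffineUnimodularLattice d → β}
    (hF : Measurable fun g : AffSL d => F (g • std d)) : Measurable F :=
  (continuous_smul_std.measurable.measurable_comp_iff_of_surjective surjective_smul_std).1 hF

theorem measurable_of_comp_prod_smul_std {β : Type*} [MeasurableSpace β]
    {F : AffSL d × AffineUnimodularLattice d → β}
    (hF : Measurable fun p : AffSL d × AffSL d => F (p.1, p.2 • std d)) :
    Measurable F := by
  have h1 : Measurable (Prod.map id fun g : AffSL d => g • std d) :=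
    (measurable_id (α := AffSL d)).prodMap continuous_smul_std.measurable
  have h2 : Function.Surjective (Prod.map (id : AffSL d → AffSL d)
      fun g : AffSL d => g • std d) :=
    Function.surjective_id.prodMap surjective_smul_std
  exact (h1.measurable_comp_iff_of_surjective h2).1 hF

instance : MeasurableConstSMul (AffSL d) (AffineUnimodularLattice d) where
  measurable_const_smul g := measurable_of_comp_smul_std (by
    simp_rw [← mul_smul]
    exact (continuous_smul_std.comp (continuous_const_mul g)).measurable)

/-- The parametrisation of the affine frames of a lattice by `SL_d(ℤ) ⋉ ℤ^d`. -/
noncomputable def frameEquiv (h : AffSL d) : Matrix.SpecialLinearGroup (Fin d) ℤ × (Fin d → ℤ) ≃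
    {b : AffSL d // b • std d = h • std d} :=
  Equiv.ofBijective (fun x => ⟨h * intAff x, smul_std_eq_iff.2 ⟨x, rfl⟩⟩)
    ⟨fun _ _ e => intAff_injective (mul_left_cancel (congrArg Subtype.val e)), fun b => by
      obtain ⟨x, hx⟩ := smul_std_eq_iff.1 b.2
      exact ⟨x, Subtype.ext hx⟩⟩

/-- The sum of a function on the group over all frames `b` of a lattice. -/
noncomputable def frameSum (Φ : AffSL d → ℝ≥0∞) (Λ : AffineUnimodularLattice d) : ℝ≥0∞ :=
  ∑' b : {b : AffSL d // b • std d = Λ}, Φ b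

theorem frameSum_smul_std (Φ : AffSL d → ℝ≥0∞) (h : AffSL d) :
    frameSum Φ (h • std d) = ∑' x, Φ (h * intAff x) :=
  ((frameEquiv h).tsum_eq _).symm

/-! ### Unfolding an invariant measure on affine lattices -/

open scoped Classical in
/-- The element of `SL_d(ℝ)` given by the transpose of the rescaling of `B` to determinant one;
the identity when `B` is singular. -/
noncomputable def toSL (B : Matrix (Fin d) (Fin d) ℝ) : Matrix.SpecialLinearGroup (Fin d) ℝ :=
  if h : (unimod B).det = 1 then ⟨(unimod B)ᵀ, by rw [Matrix.det_transpose, h]⟩ else 1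

theorem coe_toSL_of_det {B : Matrix (Fin d) (Fin d) ℝ} (h : (unimod B).det = 1) :
    (toSL B).1 = (unimod B)ᵀ := congrArg Subtype.val (dif_pos h)

theorem coe_toSL [NeZero d] {B : Matrix (Fin d) (Fin d) ℝ} (hB : 0 < B.det) :
    (toSL B).1 = (unimod B)ᵀ :=
  coe_toSL_of_det (det_unimod (NeZero.ne d) hB)

theorem toSL_mul_right [NeZero d] {B : Matrix (Fin d) (Fin d) ℝ} (hB : 0 < B.det)
    (A : Matrix.SpecialLinearGroup (Fin d) ℝ) : toSL (B * A.1ᵀ) = A * toSL B := by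
  have hA : (A.1ᵀ).det = 1 := by rw [Matrix.det_transpose, A.2]
  refine Subtype.ext ?_
  rw [coe_toSL (by rwa [Matrix.det_mul, hA, mul_one]), unimod_mul_right hA, Matrix.transpose_mul,
    Matrix.transpose_transpose, ← coe_toSL hB]
  rfl

theorem toSL_mul_left [NeZero d] {B : Matrix (Fin d) (Fin d) ℝ} (hB : 0 < B.det)
    (A : Matrix.SpecialLinearGroup (Fin d) ℝ) : toSL (A.1ᵀ * B) = toSL B * A := by
  have hA : (A.1ᵀ).det = 1 := by rw [Matrix.det_transpose, A.2]
  refine Subtype.ext ?_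
  rw [coe_toSL (by rwa [Matrix.det_mul, hA, one_mul]), unimod_mul hA, Matrix.transpose_mul,
    Matrix.transpose_transpose, ← coe_toSL hB]
  rfl

theorem measurable_coe_toSL :
    Measurable fun B : Matrix (Fin d) (Fin d) ℝ => (toSL B).1 := by
  classical
  have h : (fun B : Matrix (Fin d) (Fin d) ℝ => (toSL B).1) = fun B =>
      if (unimod B).det = 1 then (unimod B)ᵀ else 1 := by
    funext B
    split_ifs with h
    · exact coe_toSL_of_det h
    · exact congrArg Subtype.val (dif_neg h)
  rw [h]
  exact Measurable.ite (measurableSet_eq_fun (measurable_det.comp measurable_unimod)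
    measurable_const) (measurePreserving_transpose.measurable.comp measurable_unimod)
    measurable_const

/-- The map `(B, v) ↦ (toSL B, v)` from the cone times `ℝ^d` to the affine group. -/
noncomputable def toAff (p : Matrix (Fin d) (Fin d) ℝ × (Fin d → ℝ)) : AffSL d := ⟨toSL p.1, p.2⟩

theorem measurable_toAff : Measurable (toAff (d := d)) := by
  rw [← AffSL.isClosedEmbedding_matrix_prod.measurableEmbedding.measurable_comp_iff]
  exact (measurable_coe_toSL.comp measurable_fst).prodMk measurable_snd

/-- A bi-invariant measure on the affine group, from Lebesgue measure on the cone over `SL_d(ℝ)` and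
on the translations. -/
noncomputable def affMeasure (d : ℕ) : Measure (AffSL d) :=
  ((coneMeasure d).prod volume).map toAff

instance : SFinite (affMeasure d) := by unfold affMeasure; infer_instance

theorem ae_prod_coneMeasure : ∀ᵐ p ∂((coneMeasure d).prod (volume : Measure (Fin d → ℝ))),
    0 < p.1.det :=
  Measure.quasiMeasurePreserving_fst.ae (ae_coneMeasure.mono fun _ h => h.1)

theorem measurable_mulVec_toSL :
    Measurable fun p : Matrix (Fin d) (Fin d) ℝ × (Fin d → ℝ) => (toSL p.1).1 *ᵥ p.2 := by
  have h : Continuous fun p : Matrix (Fin d) (Fin d) ℝ × (Fin d → ℝ) => p.1 *ᵥ p.2 :=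
    continuous_fst.matrix_mulVec continuous_snd
  exact h.measurable.comp ((measurable_coe_toSL.comp measurable_fst).prodMk measurable_snd)

theorem measurePreserving_mulVec {h : Matrix (Fin d) (Fin d) ℝ} (hh : h.det = 1) :
    MeasurePreserving (fun v : Fin d → ℝ => h *ᵥ v) := by
  simp_rw [← Matrix.vecMul_transpose]
  exact measurePreserving_vecMul (by rw [Matrix.det_transpose, hh])

instance [NeZero d] : (affMeasure d).IsMulLeftInvariant where
  map_mul_left_eq_self g := by
    let T : Matrix (Fin d) (Fin d) ℝ × (Fin d → ℝ) → Matrix (Fin d) (Fin d) ℝ × (Fin d → ℝ) :=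
      Prod.map (fun B => B * g.lin.1ᵀ) (fun v => g.lin.1 *ᵥ v + g.trans)
    have hT : MeasurePreserving T ((coneMeasure d).prod volume) ((coneMeasure d).prod volume) :=
      (coneMeasure_mul_right (by rw [Matrix.det_transpose, g.lin.2])).prod
        ((measurePreserving_add_right volume g.trans).comp (measurePreserving_mulVec g.lin.2))
    rw [affMeasure, Measure.map_map (measurable_const_mul g) measurable_toAff]
    have h : (fun x => g * x) ∘ toAff =ᵐ[(coneMeasure d).prod volume] toAff ∘ T := by
      filter_upwards [ae_prod_coneMeasure] with p hp
      refine AffSL.ext ?_ rfl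
      exact (toSL_mul_right hp g.lin).symm
    rw [Measure.map_congr h, ← Measure.map_map measurable_toAff hT.measurable, hT.map_eq]

instance [NeZero d] : (affMeasure d).IsMulRightInvariant where
  map_mul_right_eq_self g := by
    let T : Matrix (Fin d) (Fin d) ℝ × (Fin d → ℝ) → Matrix (Fin d) (Fin d) ℝ × (Fin d → ℝ) :=
      fun p => (g.lin.1ᵀ * p.1, (toSL p.1).1 *ᵥ g.trans + p.2)
    have hT : MeasurePreserving T ((coneMeasure d).prod volume) ((coneMeasure d).prod volume) := by
      refine (coneMeasure_mul_left (by rw [Matrix.det_transpose, g.lin.2])).skew_product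
        (g := fun B v => (toSL B).1 *ᵥ g.trans + v) ?_ (Filter.Eventually.of_forall fun B =>
          map_add_left_eq_self volume _)
      exact (measurable_mulVec_toSL.comp (measurable_fst.prodMk measurable_const)).add
        measurable_snd
    rw [affMeasure, Measure.map_map (measurable_mul_const g) measurable_toAff]
    have h : (fun x => x * g) ∘ toAff =ᵐ[(coneMeasure d).prod volume] toAff ∘ T := by
      filter_upwards [ae_prod_coneMeasure] with p hp
      refine AffSL.ext ?_ rfl
      exact (toSL_mul_left hp g.lin).symm
    rw [Measure.map_congr h, ← Measure.map_map measurable_toAff hT.measurable, hT.map_eq]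

theorem measurable_frameSum {Φ : AffSL d → ℝ≥0∞} (hΦ : Measurable Φ) : Measurable (frameSum Φ) :=
  measurable_of_comp_smul_std (by
    simp_rw [frameSum_smul_std]
    exact Measurable.tsum fun x => hΦ.comp (measurable_mul_const _))

theorem measurable_frameSum_prod {Φ : AffSL d → AffSL d → ℝ≥0∞}
    (hΦ : Measurable fun p : AffSL d × AffSL d => Φ p.1 p.2) :
    Measurable fun p : AffSL d × AffineUnimodularLattice d => frameSum (Φ p.1) p.2 :=
  measurable_of_comp_prod_smul_std (by
    simp_rw [frameSum_smul_std]
    exact Measurable.tsum fun x =>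
      hΦ.comp (measurable_fst.prodMk (measurable_snd.mul_const _)))

/-- The functional `Φ ↦ ∫ frameSum Φ dμ` is left invariant, hence proportional to a Haar integral.
This is the Fubini computation behind the uniqueness of Haar measure. -/
theorem lintegral_frameSum_mul (ν : Measure (AffSL d)) [SFinite ν] [ν.IsMulLeftInvariant]
    [ν.IsMulRightInvariant] (μ : Measure (AffineUnimodularLattice d)) [SFinite μ]
    [SMulInvariantMeasure (AffSL d) (AffineUnimodularLattice d) μ]
    {Φ Θ : AffSL d → ℝ≥0∞} (hΦ : Measurable Φ) (hΘ : Measurable Θ) :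
    (∫⁻ Λ, frameSum Φ Λ ∂μ) * ∫⁻ g, Θ g ∂ν =
      (∫⁻ g, Φ g⁻¹ ∂ν) * ∫⁻ Λ, frameSum Θ Λ ∂μ := by
  have hmul : Measurable fun p : AffSL d × AffSL d => p.1 * p.2 := measurable_mul
  have hP : Measurable fun p : AffSL d × AffineUnimodularLattice d =>
      frameSum (fun b => Φ b * Θ (p.1 * b)) p.2 :=
    measurable_frameSum_prod (Φ := fun g b => Φ b * Θ (g * b))
      ((hΦ.comp measurable_snd).mul (hΘ.comp hmul))
  have hQ : Measurable fun p : AffSL d × AffineUnimodularLattice d =>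
      frameSum (fun b => Φ (p.1⁻¹ * b) * Θ b) p.2 :=
    measurable_frameSum_prod (Φ := fun g b => Φ (g⁻¹ * b) * Θ b)
      ((hΦ.comp (measurable_fst.inv.mul measurable_snd)).mul (hΘ.comp measurable_snd))
  calc (∫⁻ Λ, frameSum Φ Λ ∂μ) * ∫⁻ g, Θ g ∂ν
      = ∫⁻ Λ, frameSum Φ Λ * ∫⁻ g, Θ g ∂ν ∂μ :=
        (lintegral_mul_const _ (measurable_frameSum hΦ)).symm
    _ = ∫⁻ Λ, ∫⁻ g, frameSum (fun b => Φ b * Θ (g * b)) Λ ∂ν ∂μ := by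
        refine lintegral_congr fun Λ => ?_
        obtain ⟨h, rfl⟩ := surjective_smul_std Λ
        simp only [frameSum_smul_std]
        have hm : ∀ x, Measurable fun g => Θ (g * (h * intAff x)) := fun x =>
          hΘ.comp (measurable_mul_const _)
        rw [lintegral_tsum fun x => ((hm x).const_mul _).aemeasurable, ← ENNReal.tsum_mul_right]
        refine tsum_congr fun x => ?_
        rw [lintegral_const_mul _ (hm x), lintegral_mul_right_eq_self]
    _ = ∫⁻ g, ∫⁻ Λ, frameSum (fun b => Φ b * Θ (g * b)) Λ ∂μ ∂ν :=
        (lintegral_lintegral_swap hP.aemeasurable).symm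
    _ = ∫⁻ g, ∫⁻ Λ, frameSum (fun b => Φ (g⁻¹ * b) * Θ b) Λ ∂μ ∂ν := by
        refine lintegral_congr fun g => ?_
        have hQg : Measurable (frameSum fun b => Φ (g⁻¹ * b) * Θ b) :=
          hQ.comp measurable_prodMk_left
        rw [← (measurePreserving_smul g μ).lintegral_comp hQg]
        refine lintegral_congr fun Λ => ?_
        obtain ⟨h, rfl⟩ := surjective_smul_std Λ
        simp only [← mul_smul, frameSum_smul_std, mul_assoc, inv_mul_cancel_left]
    _ = ∫⁻ Λ, ∫⁻ g, frameSum (fun b => Φ (g⁻¹ * b) * Θ b) Λ ∂ν ∂μ :=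
        lintegral_lintegral_swap hQ.aemeasurable
    _ = ∫⁻ Λ, (∫⁻ g, Φ g⁻¹ ∂ν) * frameSum Θ Λ ∂μ := by
        refine lintegral_congr fun Λ => ?_
        obtain ⟨h, rfl⟩ := surjective_smul_std Λ
        simp only [frameSum_smul_std]
        have hm : ∀ x, Measurable fun g => Φ (g⁻¹ * (h * intAff x)) := fun x =>
          hΦ.comp (measurable_inv.mul_const _)
        rw [lintegral_tsum fun x => ((hm x).mul_const _).aemeasurable, ← ENNReal.tsum_mul_left]
        refine tsum_congr fun x => ?_
        rw [lintegral_mul_const _ (hm x)]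
        congr 1
        rw [← lintegral_mul_left_eq_self (fun g => Φ g⁻¹) (h * intAff x)⁻¹]
        simp only [mul_inv_rev, inv_inv, mul_assoc]
    _ = _ := lintegral_const_mul _ (measurable_frameSum hΘ)

/-- The weight on the affine group induced by an orbit weight; its sum over the frames of any affine
lattice is one. The unit cube takes care of the translations by lattice vectors. -/
noncomputable def affWeight (ψ : Matrix (Fin d) (Fin d) ℝ → ℝ≥0∞) (g : AffSL d) : ℝ≥0∞ :=
  ψ (g.lin.1ᵀ) * (unitCube d).indicator 1
    (((g.lin⁻¹ : Matrix.SpecialLinearGroup (Fin d) ℝ) : Matrix (Fin d) (Fin d) ℝ) *ᵥ g.trans)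

theorem measurable_affWeight {ψ : Matrix (Fin d) (Fin d) ℝ → ℝ≥0∞} (hψ : Measurable ψ) :
    Measurable (affWeight ψ) := by
  have h1 : Measurable fun g : AffSL d => (g.lin.1)ᵀ :=
    AffSL.continuous_coe_lin.matrix_transpose.measurable
  have h2 : Measurable fun g : AffSL d =>
      ((g.lin⁻¹ : Matrix.SpecialLinearGroup (Fin d) ℝ) : Matrix (Fin d) (Fin d) ℝ) *ᵥ g.trans :=
    (AffSL.continuous_coe_lin_inv.matrix_mulVec AffSL.continuous_trans).measurable
  exact (hψ.comp h1).mul ((measurable_one.indicator measurableSet_unitCube).comp h2)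

theorem frameSum_affWeight {ψ : Matrix (Fin d) (Fin d) ℝ → ℝ≥0∞} (hψ : IsOrbitWeight ψ)
    (Λ : AffineUnimodularLattice d) : frameSum (affWeight ψ) Λ = 1 := by
  obtain ⟨h, rfl⟩ := surjective_smul_std Λ
  simp only [frameSum_smul_std]
  have h1 : ∀ γ : Matrix.SpecialLinearGroup (Fin d) ℤ, ∀ p : Fin d → ℤ,
      affWeight ψ (h * intAff (γ, p)) = ψ (toR γ * h.lin.1ᵀ) * (unitCube d).indicator 1
        ((fun i => (p i : ℝ)) + ((h * intAff (γ, p)).lin⁻¹).1 *ᵥ h.trans) := by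
    intro γ p
    rw [affWeight]
    congr 2
    · change (h.lin.1 * (toR γ)ᵀ)ᵀ = _
      rw [Matrix.transpose_mul, Matrix.transpose_transpose]
    · have e1 : (h * intAff (γ, p)).trans =
          (h * intAff (γ, p)).lin.1 *ᵥ (fun i => (p i : ℝ)) + h.trans := by
        rw [AffSL.mul_trans, AffSL.mul_lin, Matrix.SpecialLinearGroup.coe_mul,
          ← Matrix.mulVec_mulVec]
        congr 2
        change latVec p (toR γ) = (toR γ)ᵀ *ᵥ _
        rw [Matrix.mulVec_transpose]
        rfl
      have e2 : ((h * intAff (γ, p)).lin⁻¹).1 * (h * intAff (γ, p)).lin.1 = 1 :=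
        congrArg Subtype.val (inv_mul_cancel (h * intAff (γ, p)).lin)
      rw [e1, Matrix.mulVec_add, Matrix.mulVec_mulVec, e2, Matrix.one_mulVec]
  have h2 : ∀ (γ : Matrix.SpecialLinearGroup (Fin d) ℤ) (p : Fin d → ℤ),
      (h * intAff (γ, p)).lin = (h * intAff (γ, 0)).lin := fun γ p => rfl
  rw [ENNReal.summable.tsum_prod' fun _ => ENNReal.summable]
  simp_rw [h1, h2, ENNReal.tsum_mul_left, tsum_unitCube, mul_one]
  exact hψ.tsum_eq_one _ (by rw [Matrix.det_transpose, h.lin.2]; exact one_pos)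

/-- Integrals over the affine group against the induced weight. -/
theorem lintegral_affWeight_mul [NeZero d] {ψ : Matrix (Fin d) (Fin d) ℝ → ℝ≥0∞}
    (hψ : Measurable ψ) {F : AffSL d → ℝ≥0∞} (hF : Measurable F) :
    ∫⁻ g, affWeight ψ g * F g ∂(affMeasure d) =
      ∫⁻ B, ψ (unimod B) * (∫⁻ t in unitCube d, F (toAff (B, t ᵥ* unimod B))) ∂(coneMeasure d) := by
  have hm : Measurable fun g => affWeight ψ g * F g := (measurable_affWeight hψ).mul hF
  rw [affMeasure, lintegral_map hm measurable_toAff]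
  refine (lintegral_prod _ (hm.comp measurable_toAff).aemeasurable).trans ?_
  refine lintegral_congr_ae ?_
  filter_upwards [ae_coneMeasure] with B hB
  have hmB : Measurable fun v : Fin d → ℝ => affWeight ψ (toAff (B, v)) * F (toAff (B, v)) :=
    (hm.comp measurable_toAff).comp measurable_prodMk_left
  have hmp := measurePreserving_vecMul (det_unimod (NeZero.ne d) hB.1)
  have hFB : Measurable fun t : Fin d → ℝ => F (toAff (B, t ᵥ* unimod B)) :=
    (hF.comp (measurable_toAff.comp measurable_prodMk_left)).comp hmp.measurable
  have hI : ∀ t, affWeight ψ (toAff (B, t ᵥ* unimod B)) =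
      ψ (unimod B) * (unitCube d).indicator 1 t := by
    intro t
    rw [affWeight]
    congr 2
    · change (toSL B).1ᵀ = _
      rw [coe_toSL hB.1, Matrix.transpose_transpose]
    · change ((toSL B)⁻¹).1 *ᵥ (t ᵥ* unimod B) = t
      have h1 : t ᵥ* unimod B = (toSL B).1 *ᵥ t := by
        rw [coe_toSL hB.1, Matrix.mulVec_transpose]
      have h2 : ((toSL B)⁻¹).1 * (toSL B).1 = 1 := congrArg Subtype.val (inv_mul_cancel (toSL B))
      rw [h1, Matrix.mulVec_mulVec, h2, Matrix.one_mulVec]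
  change ∫⁻ v, affWeight ψ (toAff (B, v)) * F (toAff (B, v)) = _
  rw [← hmp.lintegral_comp hmB, ← lintegral_const_mul _ hFB,
    ← lintegral_indicator measurableSet_unitCube]
  refine lintegral_congr fun t => ?_
  simp only [hI]
  by_cases ht : t ∈ unitCube d
  · simp [Set.indicator_of_mem ht]
  · simp [Set.indicator_of_notMem ht]

theorem IsOrbitWeight.comp_unimod [NeZero d] {ψ : Matrix (Fin d) (Fin d) ℝ → ℝ≥0∞}
    (hψ : IsOrbitWeight ψ) : IsOrbitWeight fun B => ψ (unimod B) where
  measurable := hψ.measurable.comp measurable_unimod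
  tsum_eq_one B hB := by
    simp_rw [unimod_mul (det_toR _)]
    exact hψ.tsum_eq_one _ (by rw [det_unimod (NeZero.ne d) hB]; exact one_pos)

instance {m n : ℕ} : (volume : Measure (Matrix (Fin m) (Fin n) ℝ)).IsOpenPosMeasure :=
  inferInstanceAs (volume : Measure (Fin m → Fin n → ℝ)).IsOpenPosMeasure

theorem coneMeasure_univ_ne_zero [NeZero d] : coneMeasure d Set.univ ≠ 0 := by
  have hdet : Continuous fun B : Matrix (Fin d) (Fin d) ℝ => B.det := continuous_id.matrix_det
  have hU : IsOpen {B : Matrix (Fin d) (Fin d) ℝ | 0 < B.det ∧ B.det < 1} :=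
    (isOpen_lt continuous_const hdet).inter (isOpen_lt hdet continuous_const)
  have hne : {B : Matrix (Fin d) (Fin d) ℝ | 0 < B.det ∧ B.det < 1}.Nonempty := by
    refine ⟨(2⁻¹ : ℝ) • 1, ?_⟩
    simp only [Set.mem_ofPred_eq, Matrix.det_smul, Matrix.det_one, Fintype.card_fin, mul_one]
    exact ⟨by positivity, pow_lt_one₀ (by norm_num) (by norm_num) (NeZero.ne d)⟩
  rw [coneMeasure, Measure.restrict_apply_univ]
  exact ((hU.measure_pos volume hne).trans_le (measure_mono fun B hB =>
    show 0 < B.det ∧ B.det ≤ 1 from ⟨hB.1, hB.2.le⟩)).ne'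

theorem IsOrbitWeight.lintegral_ne_zero [NeZero d] {ψ : Matrix (Fin d) (Fin d) ℝ → ℝ≥0∞}
    (hψ : IsOrbitWeight ψ) : ∫⁻ B, ψ B ∂(coneMeasure d) ≠ 0 := by
  intro h
  have h1 := hψ.lintegral_mul_tsum (Φ := fun _ => 1) measurable_const
  rw [lintegral_one] at h1
  rw [lintegral_eq_zero_iff hψ.measurable] at h
  refine coneMeasure_univ_ne_zero (d := d) ?_
  rw [← h1, ← lintegral_zero]
  refine lintegral_congr_ae ?_
  filter_upwards [h] with B hB
  rw [hB, Pi.zero_apply, zero_mul]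

/-- Unfolding: an invariant probability measure on the space of affine lattices is an average over
the unimodular lattices of the cone and over their translations by a fundamental parallelepiped. -/
theorem lintegral_eq_unfold [NeZero d] {ψ : Matrix (Fin d) (Fin d) ℝ → ℝ≥0∞}
    (hψ : IsOrbitWeight ψ) (μ : Measure (AffineUnimodularLattice d)) [IsProbabilityMeasure μ]
    [SMulInvariantMeasure (AffSL d) (AffineUnimodularLattice d) μ]
    {F : AffineUnimodularLattice d → ℝ≥0∞} (hF : Measurable F) :
    (∫⁻ Λ, F Λ ∂μ) * ∫⁻ B, ψ (unimod B) ∂(coneMeasure d) =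
      ∫⁻ B, ψ (unimod B) * (∫⁻ t in unitCube d, F (toAff (B, t ᵥ* unimod B) • std d))
        ∂(coneMeasure d) := by
  have hV0 := hψ.comp_unimod.lintegral_ne_zero
  have hVt : ∫⁻ B, ψ (unimod B) ∂(coneMeasure d) ≠ ∞ := by
    obtain _ | m := d
    · exact absurd rfl (NeZero.ne 0)
    · exact hψ.comp_unimod.lintegral_ne_top
  set V := ∫⁻ B, ψ (unimod B) ∂(coneMeasure d)
  have hΨ := measurable_affWeight hψ.measurable
  have hF' : Measurable fun g : AffSL d => F (g • std d) := hF.comp continuous_smul_std.measurable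
  have hΨF : Measurable fun g : AffSL d => affWeight ψ g * F (g • std d) := hΨ.mul hF'
  have hV : ∫⁻ g, affWeight ψ g ∂(affMeasure d) = V := by
    have := lintegral_affWeight_mul hψ.measurable (F := fun _ => 1) measurable_const
    simpa [volume_unitCube] using this
  have h1 : ∀ Λ, frameSum (fun g => affWeight ψ g * F (g • std d)) Λ = F Λ := by
    intro Λ
    have h2 : ∀ b : {b : AffSL d // b • std d = Λ},
        affWeight ψ b.1 * F (b.1 • std d) = affWeight ψ b.1 * F Λ := fun b => by rw [b.2]
    rw [frameSum, tsum_congr h2, ENNReal.tsum_mul_right]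
    change frameSum (affWeight ψ) Λ * F Λ = F Λ
    rw [frameSum_affWeight hψ, one_mul]
  have h3 := lintegral_frameSum_mul (affMeasure d) μ hΨF hΨ
  simp_rw [frameSum_affWeight hψ, h1] at h3
  rw [hV, lintegral_one, measure_univ, mul_one] at h3
  rw [h3, ← lintegral_affWeight_mul hψ.measurable hF']
  -- The factor `affWeight ψ` of total mass `V` lets Fubini show that the integral is invariant under
  -- inversion.
  have h5 := lintegral_lintegral_mul_inv (affMeasure d) (affMeasure d)
    (fun x y => affWeight ψ x * (affWeight ψ y * F (y • std d)))
    ((hΨ.comp measurable_fst).mul (hΨF.comp measurable_snd)).aemeasurable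
  have h6 : ∀ x : AffSL d, ∫⁻ y, affWeight ψ (y * x) *
      (affWeight ψ x⁻¹ * F (x⁻¹ • std d)) ∂(affMeasure d) =
        V * (affWeight ψ x⁻¹ * F (x⁻¹ • std d)) := by
    intro x
    rw [lintegral_mul_const (f := fun y => affWeight ψ (y * x)) _
      (hΨ.comp (measurable_mul_const x)),
      lintegral_mul_right_eq_self, hV]
  have h7 : ∀ x : AffSL d, ∫⁻ y, affWeight ψ x * (affWeight ψ y * F (y • std d)) ∂(affMeasure d) =
      affWeight ψ x * ∫⁻ y, (affWeight ψ y * F (y • std d)) ∂(affMeasure d) := fun x =>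
    lintegral_const_mul _ hΨF
  simp_rw [h6, h7] at h5
  rw [lintegral_mul_const _ hΨ, hV, lintegral_const_mul
    (f := fun x : AffSL d => affWeight ψ x⁻¹ * F (x⁻¹ • std d)) _ (hΨF.comp measurable_inv)] at h5
  exact (ENNReal.mul_right_inj hV0 hVt).1 h5

/-! ### Moments of lattice sums -/

/-- The sum of a nonnegative function over all points of an affine lattice. -/
noncomputable def latticeSum (f : (Fin d → ℝ) → ℝ≥0∞) (Λ : AffineUnimodularLattice d) : ℝ≥0∞ :=
  ∑' z : Λ.1, f z

theorem toFun_injective (g : AffSL d) : Function.Injective g.toFun := by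
  refine Function.LeftInverse.injective (g := g⁻¹.toFun) fun w => ?_
  rw [← AffSL.toFun_mul, inv_mul_cancel, AffSL.toFun_one]

theorem latticeSum_smul_std (f : (Fin d → ℝ) → ℝ≥0∞) (g : AffSL d) :
    latticeSum f (g • std d) = ∑' p : Fin d → ℤ, f (g.toFun fun i => (p i : ℝ)) := by
  have hinj : Function.Injective fun p : Fin d → ℤ => g.toFun fun i => (p i : ℝ) := by
    intro p q h
    ext i
    exact_mod_cast congrFun (toFun_injective g h) i
  have hset : (g • std d).1 = Set.range fun p : Fin d → ℤ => g.toFun fun i => (p i : ℝ) := by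
    rw [coe_smul_std, stdLattice, ← Set.range_comp]; rfl
  rw [latticeSum, hset]
  exact tsum_range f hinj

theorem measurable_latticeSum {f : (Fin d → ℝ) → ℝ≥0∞} (hf : Measurable f) :
    Measurable (latticeSum f) :=
  measurable_of_comp_smul_std (by
    simp_rw [latticeSum_smul_std]
    exact Measurable.tsum fun p => hf.comp (AffSL.measurable_toFun _))

theorem latticeSum_toAff [NeZero d] (f : (Fin d → ℝ) → ℝ≥0∞) {B : Matrix (Fin d) (Fin d) ℝ}
    (hB : 0 < B.det) (t : Fin d → ℝ) :
    latticeSum f (toAff (B, t ᵥ* unimod B) • std d) =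
      ∑' p : Fin d → ℤ, f (((fun i => (p i : ℝ)) + t) ᵥ* unimod B) := by
  rw [latticeSum_smul_std]
  refine tsum_congr fun p => ?_
  rw [Matrix.add_vecMul, AffSL.toFun]
  change f ((toSL B).1 *ᵥ _ + t ᵥ* unimod B) = _
  rw [coe_toSL hB, Matrix.mulVec_transpose]

theorem exists_isOrbitWeight_unimod (d : ℕ) [NeZero d] :
    ∃ ψ : Matrix (Fin d) (Fin d) ℝ → ℝ≥0∞, IsOrbitWeight ψ ∧
      ∫⁻ B, ψ (unimod B) ∂(coneMeasure d) ≠ 0 ∧ ∫⁻ B, ψ (unimod B) ∂(coneMeasure d) ≠ ∞ := by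
  obtain ⟨ψ, hψ⟩ := exists_isOrbitWeight d
  refine ⟨ψ, hψ, hψ.comp_unimod.lintegral_ne_zero, ?_⟩
  obtain _ | m := d
  · exact absurd rfl (NeZero.ne 0)
  · exact hψ.comp_unimod.lintegral_ne_top

/-- First moment of lattice sums: translations alone equidistribute a lattice point. -/
theorem lintegral_latticeSum [NeZero d] (μ : Measure (AffineUnimodularLattice d))
    [IsProbabilityMeasure μ] [SMulInvariantMeasure (AffSL d) (AffineUnimodularLattice d) μ]
    {f : (Fin d → ℝ) → ℝ≥0∞} (hf : Measurable f) :
    ∫⁻ Λ, latticeSum f Λ ∂μ = ∫⁻ x, f x := by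
  obtain ⟨ψ, hψ, hV0, hVt⟩ := exists_isOrbitWeight_unimod d
  have h := lintegral_eq_unfold hψ μ (measurable_latticeSum hf)
  have h1 : ∫⁻ B, ψ (unimod B) * (∫⁻ t in unitCube d,
      latticeSum f (toAff (B, t ᵥ* unimod B) • std d)) ∂(coneMeasure d) =
      ∫⁻ B, ψ (unimod B) * (∫⁻ x, f x) ∂(coneMeasure d) := by
    refine lintegral_congr_ae ?_
    filter_upwards [ae_coneMeasure] with B hB
    have hmp := measurePreserving_vecMul (det_unimod (NeZero.ne d) hB.1)
    simp_rw [latticeSum_toAff f hB.1]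
    rw [setLIntegral_unitCube_tsum (G := fun t => f (t ᵥ* unimod B)) (hf.comp hmp.measurable),
      hmp.lintegral_comp hf]
  rw [h1, lintegral_mul_const _ hψ.comp_unimod.measurable, mul_comm] at h
  exact (ENNReal.mul_right_inj hV0 hVt).1 h

/-- For a fixed unimodular lattice, the square of a lattice sum averaged over translations. -/
theorem setLIntegral_tsum_sq {f : (Fin d → ℝ) → ℝ≥0∞} (hf : Measurable f)
    {B : Matrix (Fin d) (Fin d) ℝ} (hB : B.det = 1) :
    ∫⁻ t in unitCube d, (∑' p : Fin d → ℤ, f (((fun i => (p i : ℝ)) + t) ᵥ* B)) ^ 2 =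
      ∑' q : Fin d → ℤ, ∫⁻ x, f x * f (x + latVec q B) := by
  have hmp := measurePreserving_vecMul hB
  let K : (Fin d → ℝ) → ℝ≥0∞ := fun x => f x * ∑' q : Fin d → ℤ, f (x + latVec q B)
  have hK : Measurable K :=
    hf.mul (Measurable.tsum fun q => hf.comp (measurable_add_const _))
  have h1 : ∀ t : Fin d → ℝ, (∑' p : Fin d → ℤ, f (((fun i => (p i : ℝ)) + t) ᵥ* B)) ^ 2 =
      ∑' p : Fin d → ℤ, K (((fun i => (p i : ℝ)) + t) ᵥ* B) := by
    intro t
    rw [sq, ← ENNReal.tsum_mul_right]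
    refine tsum_congr fun p => ?_
    simp only [K]
    congr 1
    rw [← (Equiv.addLeft p).tsum_eq]
    refine tsum_congr fun q => ?_
    rw [Equiv.coe_addLeft, vecMul_add_latVec, vecMul_add_latVec, latVec_add]
    congr 1
    abel
  simp_rw [h1]
  rw [setLIntegral_unitCube_tsum (G := fun t => K (t ᵥ* B)) (hK.comp hmp.measurable),
    hmp.lintegral_comp hK]
  simp only [K, ← ENNReal.tsum_mul_left]
  exact lintegral_tsum fun q => (hf.mul (hf.comp (measurable_add_const _))).aemeasurable

/-- Second moment of lattice sums. -/
theorem lintegral_latticeSum_sq {k : ℕ} (μ : Measure (AffineUnimodularLattice (k + 2)))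
    [IsProbabilityMeasure μ]
    [SMulInvariantMeasure (AffSL (k + 2)) (AffineUnimodularLattice (k + 2)) μ]
    {f : (Fin (k + 2) → ℝ) → ℝ≥0∞} (hf : Measurable f) :
    ∫⁻ Λ, latticeSum f Λ ^ 2 ∂μ = (∫⁻ x, f x ^ 2) + (∫⁻ x, f x) ^ 2 := by
  obtain ⟨ψ, hψ, hV0, hVt⟩ := exists_isOrbitWeight_unimod (k + 2)
  have h := lintegral_eq_unfold hψ μ ((measurable_latticeSum hf).pow_const 2)
  let H : (Fin (k + 2) → ℝ) → ℝ≥0∞ := fun u => ∫⁻ x, f x * f (x + u)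
  have hH2 : Measurable fun p : (Fin (k + 2) → ℝ) × (Fin (k + 2) → ℝ) =>
      f p.2 * f (p.2 + p.1) :=
    (hf.comp measurable_snd).mul (hf.comp (measurable_snd.add measurable_fst))
  have hH : Measurable H := hH2.lintegral_prod_right'
  have hHint : ∫⁻ u, H u = (∫⁻ x, f x) ^ 2 := by
    calc ∫⁻ u, H u = ∫⁻ x, ∫⁻ u, f x * f (x + u) := lintegral_lintegral_swap hH2.aemeasurable
      _ = ∫⁻ x, f x * ∫⁻ y, f y := by
          refine lintegral_congr fun x => ?_
          have h2 : Measurable fun u => f (x + u) := hf.comp (measurable_const_add x)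
          rw [lintegral_const_mul _ h2, lintegral_add_left_eq_self]
      _ = _ := by rw [lintegral_mul_const _ hf, sq]
  have hH0 : H 0 = ∫⁻ x, f x ^ 2 := by simp only [H, add_zero, sq]
  have h1 : ∫⁻ B, ψ (unimod B) * (∫⁻ t in unitCube (k + 2),
      latticeSum f (toAff (B, t ᵥ* unimod B) • std (k + 2)) ^ 2) ∂(coneMeasure (k + 2)) =
      ∫⁻ B, (ψ (unimod B) * H 0 + ψ (unimod B) * ∑' q : {q : Fin (k + 2) → ℤ // q ≠ 0},
        H (latVec q.1 (unimod B))) ∂(coneMeasure (k + 2)) := by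
    refine lintegral_congr_ae ?_
    filter_upwards [ae_coneMeasure] with B hB
    simp_rw [latticeSum_toAff f hB.1]
    rw [setLIntegral_tsum_sq hf (det_unimod (by omega) hB.1), ← mul_add]
    congr 1
    have h2 : ∑' q : ({0} : Set (Fin (k + 2) → ℤ)), H (latVec q.1 (unimod B)) +
        ∑' q : (({0} : Set (Fin (k + 2) → ℤ))ᶜ : Set _), H (latVec q.1 (unimod B)) =
          ∑' q, H (latVec q (unimod B)) :=
      Summable.tsum_add_tsum_compl (f := fun q => H (latVec q (unimod B)))
        (s := ({0} : Set (Fin (k + 2) → ℤ))) ENNReal.summable ENNReal.summable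
    rw [tsum_singleton (0 : Fin (k + 2) → ℤ) fun q => H (latVec q (unimod B))] at h2
    have h3 : latVec (0 : Fin (k + 2) → ℤ) (unimod B) = 0 := by simp [latVec, ← Pi.zero_def]
    rw [h3] at h2
    exact h2.symm
  have hm := hψ.comp_unimod.measurable
  rw [h1, lintegral_add_left (hm.mul_const _), lintegral_mul_const _ hm,
    siegel_mean_value hψ.comp_unimod hH, ← mul_add, mul_comm, hHint, hH0] at h
  exact (ENNReal.mul_right_inj hV0 hVt).1 h

/-- The moments of the lattice sum of a nonnegative real function. -/
theorem moments_of_nonneg {k : ℕ} (μ : Measure (AffineUnimodularLattice (k + 2)))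
    [IsProbabilityMeasure μ]
    [SMulInvariantMeasure (AffSL (k + 2)) (AffineUnimodularLattice (k + 2)) μ]
    {h : (Fin (k + 2) → ℝ) → ℝ} (hm : Measurable h) (h0 : ∀ x, 0 ≤ h x)
    (h1 : Integrable h) (h2 : Integrable fun x => h x ^ 2) :
    (∀ᵐ Λ ∂μ, latticeSum (fun x => ENNReal.ofReal (h x)) Λ ≠ ∞) ∧
    MemLp (fun Λ => (latticeSum (fun x => ENNReal.ofReal (h x)) Λ).toReal) 2 μ ∧
    ∫ Λ, (latticeSum (fun x => ENNReal.ofReal (h x)) Λ).toReal ∂μ = ∫ x, h x ∧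
    ∫ Λ, (latticeSum (fun x => ENNReal.ofReal (h x)) Λ).toReal ^ 2 ∂μ =
      (∫ x, h x ^ 2) + (∫ x, h x) ^ 2 := by
  have hmE : Measurable fun x => ENNReal.ofReal (h x) := ENNReal.measurable_ofReal.comp hm
  have hS := measurable_latticeSum hmE
  have e1 := lintegral_latticeSum μ hmE
  have e2 := lintegral_latticeSum_sq μ hmE
  rw [← ofReal_integral_eq_lintegral_ofReal h1 (Filter.Eventually.of_forall h0)] at e1 e2
  simp_rw [← ENNReal.ofReal_pow (h0 _)] at e2
  rw [← ofReal_integral_eq_lintegral_ofReal h2 (Filter.Eventually.of_forall fun x => sq_nonneg _)]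
    at e2
  have i1 : 0 ≤ ∫ x, h x := integral_nonneg h0
  have i2 : 0 ≤ ∫ x, h x ^ 2 := integral_nonneg fun x => sq_nonneg _
  have hfin : ∀ᵐ Λ ∂μ, latticeSum (fun x => ENNReal.ofReal (h x)) Λ < ∞ :=
    ae_lt_top hS (by rw [e1]; exact ENNReal.ofReal_ne_top)
  have hfin2 : ∀ᵐ Λ ∂μ, latticeSum (fun x => ENNReal.ofReal (h x)) Λ ^ 2 < ∞ := by
    filter_upwards [hfin] with Λ hΛ using ENNReal.pow_lt_top hΛ
  have e3 : ∫ Λ, (latticeSum (fun x => ENNReal.ofReal (h x)) Λ).toReal ^ 2 ∂μ =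
      (∫ x, h x ^ 2) + (∫ x, h x) ^ 2 := by
    simp_rw [← ENNReal.toReal_pow]
    rw [integral_toReal (hS.pow_const 2).aemeasurable hfin2, e2, ← ENNReal.ofReal_pow i1,
      ← ENNReal.ofReal_add i2 (sq_nonneg _), ENNReal.toReal_ofReal (by positivity)]
  refine ⟨hfin.mono fun _ h => h.ne, ?_, ?_, e3⟩
  · rw [memLp_two_iff_integrable_sq hS.ennreal_toReal.aestronglyMeasurable]
    simp_rw [← ENNReal.toReal_pow]
    exact integrable_toReal_of_lintegral_ne_top (hS.pow_const 2).aemeasurable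
      (by rw [e2]; finiteness)
  · rw [integral_toReal hS.aemeasurable hfin, e1, ENNReal.toReal_ofReal i1]

/-! ### Signed functions -/

/-- Almost every affine lattice avoids a given null set. -/
theorem ae_forall_mem_notMem {d : ℕ} [NeZero d] (μ : Measure (AffineUnimodularLattice d))
    [IsProbabilityMeasure μ] [SMulInvariantMeasure (AffSL d) (AffineUnimodularLattice d) μ]
    {N : Set (Fin d → ℝ)} (hN : volume N = 0) : ∀ᵐ Λ ∂μ, ∀ z ∈ Λ.1, z ∉ N := by
  have hm : Measurable ((toMeasurable volume N).indicator (1 : (Fin d → ℝ) → ℝ≥0∞)) :=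
    measurable_one.indicator (measurableSet_toMeasurable _ _)
  have h := lintegral_latticeSum μ hm
  rw [lintegral_indicator_one (measurableSet_toMeasurable _ _), measure_toMeasurable, hN,
    lintegral_eq_zero_iff (measurable_latticeSum hm)] at h
  filter_upwards [h] with Λ hΛ z hz hzN
  have h1 := ENNReal.tsum_eq_zero.1 hΛ ⟨z, hz⟩
  simp [Set.indicator_of_mem (subset_toMeasurable volume N hzN)] at h1

/-- Polarization for square integrable functions. -/
theorem integral_sub_sq {α : Type*} {m : MeasurableSpace α} {ν : Measure α} {p q : α → ℝ}
    (hp : MemLp p 2 ν) (hq : MemLp q 2 ν) :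
    ∫ x, (p x - q x) ^ 2 ∂ν =
      2 * (∫ x, p x ^ 2 ∂ν) + 2 * (∫ x, q x ^ 2 ∂ν) - ∫ x, (p x + q x) ^ 2 ∂ν := by
  have hp2 : Integrable (fun x => 2 * p x ^ 2) ν := hp.integrable_sq.const_mul 2
  have hq2 : Integrable (fun x => 2 * q x ^ 2) ν := hq.integrable_sq.const_mul 2
  have hs : Integrable (fun x => (p x + q x) ^ 2) ν := (hp.add hq).integrable_sq
  have hpq : Integrable (fun x => 2 * p x ^ 2 + 2 * q x ^ 2) ν := hp2.add hq2
  rw [← integral_const_mul, ← integral_const_mul, ← integral_add hp2 hq2, ← integral_sub hpq hs]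
  exact integral_congr_ae (.of_forall fun x => by ring)

end SiegelMean

open SiegelMean in
theorem proposition3p18 (d : ℕ) (hd : 2 ≤ d)
    (μ : Measure (AffineUnimodularLattice d)) [IsProbabilityMeasure μ]
    [SMulInvariantMeasure (AffSL d) (AffineUnimodularLattice d) μ]
    (f : (Fin d → ℝ) → ℝ) (hf₁ : MemLp f 1 volume) (hf₂ : MemLp f 2 volume) :
    (∀ᵐ Λ : AffineUnimodularLattice d ∂μ, Summable fun z : ↥(Λ.1 \ {0}) => f z) ∧
    MemLp (siegelTransform f) 2 μ ∧
    ∫ Λ, siegelTransform f Λ ∂μ = ∫ x, f x ∧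
    ∫ Λ, siegelTransform f Λ ^ 2 ∂μ = (∫ x, f x) ^ 2 + ∫ x, f x ^ 2 := by
  obtain ⟨k, rfl⟩ : ∃ k, d = k + 2 := ⟨d - 2, by omega⟩
  obtain ⟨g, hgm, hfg⟩ : ∃ g, Measurable g ∧ f =ᵐ[volume] g :=
    ⟨_, hf₁.1.stronglyMeasurable_mk.measurable, hf₁.1.ae_eq_mk⟩
  have hg₁ : Integrable g := (memLp_one_iff_integrable.1 hf₁).congr hfg
  have hg₂ : Integrable fun x => g x ^ 2 :=
    (memLp_two_iff_integrable_sq hgm.aestronglyMeasurable).1 (hf₂.ae_eq hfg)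
  have hbound : ∀ h : (Fin (k + 2) → ℝ) → ℝ, Measurable h → (∀ x, |h x| ≤ |g x|) →
      Integrable h ∧ Integrable fun x => h x ^ 2 := by
    intro h hm hle
    refine ⟨hg₁.mono hm.aestronglyMeasurable (.of_forall hle),
      hg₂.mono (hm.pow_const 2).aestronglyMeasurable (.of_forall fun x => ?_)⟩
    rw [norm_pow, norm_pow]
    exact pow_le_pow_left₀ (norm_nonneg _) (hle x) 2
  have hpm : Measurable fun x => max (g x) 0 := hgm.max measurable_const
  have hqm : Measurable fun x => max (-g x) 0 := hgm.neg.max measurable_const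
  have hp := hbound _ hpm fun x => by
    rw [abs_of_nonneg (le_max_right _ _)]; exact max_le (le_abs_self _) (abs_nonneg _)
  have hq := hbound _ hqm fun x => by
    rw [abs_of_nonneg (le_max_right _ _)]; exact max_le (neg_le_abs _) (abs_nonneg _)
  have ha := hbound _ hgm.abs fun x => (abs_abs _).le
  obtain ⟨pfin, pL, pint, psq⟩ := moments_of_nonneg μ hpm (fun _ => le_max_right _ _) hp.1 hp.2
  obtain ⟨qfin, qL, qint, qsq⟩ := moments_of_nonneg μ hqm (fun _ => le_max_right _ _) hq.1 hq.2
  obtain ⟨-, aL, -, asq⟩ := moments_of_nonneg μ hgm.abs (fun _ => abs_nonneg _) ha.1 ha.2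
  set P := fun Λ => (latticeSum (fun x => ENNReal.ofReal (max (g x) 0)) Λ).toReal with hP
  set Q := fun Λ => (latticeSum (fun x => ENNReal.ofReal (max (-g x) 0)) Λ).toReal with hQ
  have hadd : ∀ x, |g x| = max (g x) 0 + max (-g x) 0 := fun x =>
    (posPart_add_negPart (g x)).symm
  have hsub : ∀ x, g x = max (g x) 0 - max (-g x) 0 := fun x =>
    (posPart_sub_negPart (g x)).symm
  have hN : volume ({x | f x ≠ g x} ∪ {0}) = 0 := measure_union_null hfg (measure_singleton _)
  have key : ∀ᵐ Λ : AffineUnimodularLattice (k + 2) ∂μ,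
      HasSum (fun z : ↥(Λ.1 \ {0}) => f z) (P Λ - Q Λ) ∧
      (latticeSum (fun x => ENNReal.ofReal |g x|) Λ).toReal = P Λ + Q Λ := by
    filter_upwards [pfin, qfin, ae_forall_mem_notMem μ hN] with Λ h1 h2 h3
    have h0 : Λ.1 \ {0} = Λ.1 :=
      Set.sdiff_singleton_eq_self fun h => h3 0 h (Set.mem_union_right _ rfl)
    have hsum : ∀ h : (Fin (k + 2) → ℝ) → ℝ, (∀ x, 0 ≤ h x) →
        latticeSum (fun x => ENNReal.ofReal (h x)) Λ ≠ ∞ → HasSum (fun z : Λ.1 => h z)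
          (latticeSum (fun x => ENNReal.ofReal (h x)) Λ).toReal := by
      intro h h0 hfin
      have := ENNReal.hasSum_toReal hfin
      simp only [ENNReal.toReal_ofReal (h0 _)] at this
      rwa [latticeSum, ENNReal.tsum_toReal_eq fun z => ENNReal.ofReal_ne_top,
        tsum_congr fun z : Λ.1 => ENNReal.toReal_ofReal (h0 z)]
    have s1 := hsum _ (fun x => le_max_right (g x) 0) h1
    have s2 := hsum _ (fun x => le_max_right (-g x) 0) h2
    constructor
    · rw [h0]
      refine (s1.sub s2).congr_fun fun z => ?_
      rw [← hsub, not_not.1 fun h => h3 z z.2 (Set.mem_union_left _ h)]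
    · rw [hP, hQ, ← ENNReal.toReal_add h1 h2]
      simp only [latticeSum]
      rw [← ENNReal.tsum_add]
      congr 1
      refine tsum_congr fun z => ?_
      rw [hadd, ENNReal.ofReal_add (le_max_right _ _) (le_max_right _ _)]
  have hT : siegelTransform f =ᵐ[μ] fun Λ => P Λ - Q Λ := by
    filter_upwards [key] with Λ h using h.1.tsum_eq
  have hPQ : MemLp (fun Λ => P Λ - Q Λ) 2 μ := pL.sub qL
  refine ⟨key.mono fun Λ h => h.1.summable, hPQ.ae_eq hT.symm, ?_, ?_⟩
  · rw [integral_congr_ae hT, integral_congr_ae hfg,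
      integral_sub (pL.integrable one_le_two) (qL.integrable one_le_two), pint, qint,
      ← integral_sub hp.1 hq.1]
    simp_rw [← hsub]
  · have hp2 := (memLp_two_iff_integrable_sq hpm.aestronglyMeasurable).2 hp.2
    have hq2 := (memLp_two_iff_integrable_sq hqm.aestronglyMeasurable).2 hq.2
    have e1 : ∫ Λ, siegelTransform f Λ ^ 2 ∂μ = ∫ Λ, (P Λ - Q Λ) ^ 2 ∂μ :=
      integral_congr_ae (hT.mono fun Λ h => by simp only [h])
    have e2 : ∫ Λ, (P Λ + Q Λ) ^ 2 ∂μ = (∫ x, |g x| ^ 2) + (∫ x, |g x|) ^ 2 := by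
      rw [← asq]
      exact integral_congr_ae (key.mono fun Λ h => by simp only [h.2])
    have e3 : ∫ x, f x ^ 2 = ∫ x, g x ^ 2 :=
      integral_congr_ae (hfg.mono fun x h => by simp only [h])
    have e4 := integral_sub_sq hp2 hq2
    simp only [← hsub, ← hadd] at e4
    have e5 : ∫ x, |g x| = (∫ x, max (g x) 0) + ∫ x, max (-g x) 0 := by
      rw [← integral_add hp.1 hq.1]; simp_rw [hadd]
    have e6 : ∫ x, g x = (∫ x, max (g x) 0) - ∫ x, max (-g x) 0 := by
      rw [← integral_sub hp.1 hq.1]; simp_rw [← hsub]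
    rw [e1, integral_sub_sq pL qL, psq, qsq, e2, e3, integral_congr_ae hfg, e4, e5, e6]
    ring
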